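/- **Setting.** Consider a discounted Markov decision process (MDP) with state space $\mathcal S\subseteq\mathbb R^d$, action space $\mathcal A$, transition kernel $p(\cdot\mid s,a)$, measurable reward function $\mathcal R:\mathcal S\times\mathcal A\to[0,R_{\max}]$ with $0<R_{\max}<\infty$, and discount factor $\gamma\in(0,1)$. For a stationary policy $\pi$ let $V^\pi(s)=\mathbb E_\pi\big[\sum_{t\ge0}\gamma^t\mathcal R(s_t,a_t)\mid s_0=s\big]$, and let $V^*(s)=\sup_\pi V^\pi(s)$, $Q^*(s,a)=\mathcal R(s,a)+\gamma\,\mathbb E[V^*(s_1)\mid s_0=s,a_0=a]$, $\mathcal A^*(s)=\arg\max_a Q^*(s,a)$. The optimal policy $\pi^*(\cdot\mid s)$ is uniform on $\mathcal A^*(s)$. Let $\Delta_{\min}=\inf_s\big(\max_a Q^*(s,a)-\max_{a\notin\mathcal A^*(s)}Q^*(s,a)\big)$, where $\max\emptyset=-\infty$, and assume $\Delta_{\min}>0$ ($\Delta_{\min}=+\infty$ is allowed). **Condition 1.** $\mathcal A$ is finite (and non-empty) and $\mathcal S\subseteq\mathbb R^d$ is unbounded. **Condition 2.** There are a measurable $L:\mathcal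 S\to[0,\infty)$ and $\nu,\nu',B,\alpha>0$ such that $L(s)\to\infty$ as $\|s\|_2\to\infty$; $\sup\{\|s\|_2: L(s)\le\ell\}<\infty$ for every finite $\ell$; for all $s\in\mathcal S$, $a\in\mathcal A$, the next state $s'\sim p(\cdot\mid s,a)$ satisfies $|L(s')-L(s)|\le\nu$ and $\|s'-s\|_2\le\nu'$ almost surely; and $\mathbb E_{\pi^*}[L(s_{t+1})-L(s_t)\mid s_t=s]\le-\alpha$ for every $s$ with $L(s)>B$. **Policy.** The sparse-sampling oracle with integer parameters $C,H>0$, queried at $s$, builds a tree of depth $H$ with root $s$: at every node above depth $H$ and for each $a\in\mathcal A$, $C$ next states are sampled independently from $p(\cdot\mid s',a)$, where $s'$ is the state of the node, and become its children. Leaves get value $0$; going upwards, $\widehat Q(s',a)=\mathcal R(s',a)+\gamma\frac1C\sum\widehat V(\text{child})$, the sum being over the $C$ children of the node for the action $a$, and $\widehat V(s')=\max_a\widehat Q(s',a)$. The oracle returns the estimates $\widehat Q(s,\cdot)$ at the root. At each time the policy queries the oracle afresh in the current state $s_t$ and draws $a_t$ from the Boltzmann distribution $e^{\widehat Q(s_t,a)/\tau}/\sum_{a'}e^{\widehat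 Q(s_t,a')/\tau}$. The parameters are $\delta=\tau^2$, $$H=\lceil\log_\gamma\delta\rceil,\qquad C=\max\left\{1,\left\lceil\frac{2\gamma^2}{\delta^2(1-\gamma)^2}\Big(2H\log\frac{2\gamma^2|\mathcal A|H}{\delta^2(1-\gamma)^2}+\log\frac2\delta\Big)\right\rceil\right\}.$$ **Theorem.** Assume Conditions 1 and 2, and let $$0<\tau\le\tau(\alpha)=\min\left\{\sqrt{\frac{\alpha}{24\nu}},\ \frac{1-\gamma}{8R_{\max}},\ \frac{(1-\gamma)\alpha}{48R_{\max}|\mathcal A|^2\nu},\ \frac{\Delta_{\min}}{\ln(24\nu|\mathcal A|/\alpha)}\right\}.$$ Then the policy is stable: for every $\theta\in(0,1)$ there is a bounded (measurable) set $\mathcal S(\theta)\subset\mathcal S$ such that for every $s\in\mathcal S$ 1. $\limsup_{t\to\infty}\mathbb P(s_t\notin\mathcal S(\theta)\mid s_0=s)\le\theta$, and 2. $\sup_{t\ge0}\mathbb E[T(s,t,\theta)\mid s_t=s]<\infty$, where $T(s,t,\theta)=\inf\{k\ge0: s_{t+k}\in\mathcal S(\theta)\}$ is the hitting time of $\mathcal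 S(\theta)$ counted from time $t$ (with $\inf\emptyset=\infty$). -/

import Mathlib

open MeasureTheory ProbabilityTheory Filter
open scoped ENNReal

noncomputable section

namespace StableRL

/-! ## Two kernels: independent products and Boltzmann sampling -/

/-- Given a state, draw finitely many coordinates independently, coordinate `i` with law `κ i`. -/
def indepKernel {ι S X : Type*} [Fintype ι] [MeasurableSpace S] [MeasurableSpace X]
    (κ : ι → Kernel S X) [∀ i, IsMarkovKernel (κ i)] : Kernel S (ι → X) where
  toFun s := Measure.pi fun i => κ i s
  measurable' := by
    refine Measurable.measure_of_isPiSystem_of_isProbabilityMeasure generateFrom_pi.symm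
      isPiSystem_pi ?_
    rintro _ ⟨t, ht, rfl⟩
    simp only [Set.mem_pi, Set.mem_univ, true_implies, Set.mem_ofPred_eq] at ht
    simp only [Measure.pi_pi]
    exact Finset.measurable_prod _ fun i _ => Kernel.measurable_coe (κ i) (ht i)

instance {ι S X : Type*} [Fintype ι] [MeasurableSpace S] [MeasurableSpace X]
    (κ : ι → Kernel S X) [∀ i, IsMarkovKernel (κ i)] : IsMarkovKernel (indepKernel κ) :=
  ⟨fun s => inferInstanceAs (IsProbabilityMeasure (Measure.pi fun i => κ i s))⟩

/-- The Boltzmann weight of the action `a` at temperature `τ`, for the vector `q` of Q-values. -/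
def boltzmannWeight {A : Type*} [Fintype A] (τ : ℝ) (q : A → ℝ) (a : A) : ℝ :=
  Real.exp (q a / τ) / ∑ b, Real.exp (q b / τ)

/-- Draw one action with the Boltzmann weights of the vector of Q-values. -/
def boltzmannKernel (A : Type*) [Fintype A] [MeasurableSpace A] (τ : ℝ) :
    Kernel (A → ℝ) A where
  toFun q := ∑ a, ENNReal.ofReal (boltzmannWeight τ q a) • Measure.dirac a
  measurable' := by
    refine Measure.measurable_of_measurable_coe _ fun t _ => ?_
    simp only [Measure.coe_finsetSum, Finset.sum_apply, Measure.smul_apply, smul_eq_mul]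
    refine Finset.measurable_sum _ fun a _ => Measurable.mul_const ?_ _
    unfold boltzmannWeight
    fun_prop

instance (A : Type*) [Fintype A] [Nonempty A] [MeasurableSpace A] (τ : ℝ) :
    IsMarkovKernel (boltzmannKernel A τ) := by
  refine ⟨fun q => ⟨?_⟩⟩
  change (∑ a, ENNReal.ofReal (boltzmannWeight τ q a) • Measure.dirac a) Set.univ = 1
  have hpos : 0 < ∑ b, Real.exp (q b / τ) :=
    Finset.sum_pos (fun b _ => Real.exp_pos _) Finset.univ_nonempty
  simp only [Measure.coe_finsetSum, Finset.sum_apply, Measure.smul_apply, smul_eq_mul,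
    measure_univ, mul_one]
  rw [← ENNReal.ofReal_sum_of_nonneg fun a _ => by unfold boltzmannWeight; positivity]
  unfold boltzmannWeight
  rw [← Finset.sum_div, div_self hpos.ne', ENNReal.ofReal_one]

/-! ## Discounted Markov decision processes -/

/-- A discounted MDP with state space `S`, action space `A`, transition kernel `trans`
(`trans (s, a)` is the law of the next state), reward function with values in `[0, Rmax]`
and discount factor `γ ∈ (0, 1)`. -/
structure MDP (S A : Type*) [MeasurableSpace S] [MeasurableSpace A] where
  trans : Kernel (S × A) S
  markov : IsMarkovKernel trans
  reward : S → A → ℝ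
  measurable_reward : Measurable (Function.uncurry reward)
  Rmax : ℝ
  Rmax_pos : 0 < Rmax
  reward_nonneg : ∀ s a, 0 ≤ reward s a
  reward_le : ∀ s a, reward s a ≤ Rmax
  γ : ℝ
  γ_pos : 0 < γ
  γ_lt_one : γ < 1

attribute [instance] MDP.markov

/-- A one-step decision rule: a (randomized) choice of an action in each state. -/
abbrev Policy (S A : Type*) [MeasurableSpace S] [MeasurableSpace A] : Type _ :=
  {π : Kernel S A // IsMarkovKernel π}

instance {S A : Type*} [MeasurableSpace S] [MeasurableSpace A] (π : Policy S A) :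
    IsMarkovKernel π.1 := π.2

namespace MDP

variable {S A : Type*} [MeasurableSpace S] [MeasurableSpace A]

/-- One step of the state-action process: from `(s, a)` go to `s' ∼ trans (s, a)`, then choose
`a' ∼ π(· | s')`. -/
def stepKernel (M : MDP S A) (π : Policy S A) : Kernel (S × A) (S × A) :=
  M.trans ⊗ₖ Kernel.prodMkLeft (S × A) π.1

instance (M : MDP S A) (π : Policy S A) : IsMarkovKernel (M.stepKernel π) :=
  inferInstanceAs (IsMarkovKernel (M.trans ⊗ₖ Kernel.prodMkLeft (S × A) π.1))

/-- The same step as a function of the whole past up to time `n`, only the present being used. -/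
def historyKernel (M : MDP S A) (π : Policy S A) (n : ℕ) :
    Kernel (Π _ : Finset.Iic n, S × A) (S × A) :=
  (M.stepKernel π).comap (fun h => h ⟨n, Finset.mem_Iic.2 le_rfl⟩) (by fun_prop)

instance (M : MDP S A) (π : Policy S A) (n : ℕ) : IsMarkovKernel (M.historyKernel π n) :=
  inferInstanceAs (IsMarkovKernel ((M.stepKernel π).comap _ _))

/-- Law of the trajectory `(s₀, a₀), (s₁, a₁), …` that starts in `s₀ = s` and chooses the action
`aₜ ∼ πₜ(· | sₜ)` at each time `t`. -/
def pathLaw (M : MDP S A) (π : ℕ → Policy S A) (s : S) : Measure (ℕ → S × A) :=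
  Kernel.trajMeasure (X := fun _ => S × A) (((π 0).1 s).map (Prod.mk s))
    (fun n => M.historyKernel (π (n + 1)) n)

/-! ### Value functions and optimal actions -/

/-- Value function of a stationary policy. -/
def value (M : MDP S A) (π : Policy S A) (s : S) : ℝ :=
  ∫ ω, ∑' t : ℕ, M.γ ^ t * M.reward (ω t).1 (ω t).2 ∂(M.pathLaw (fun _ => π) s)

/-- Optimal value function `V*`. -/
def optValue (M : MDP S A) (s : S) : ℝ := ⨆ π : Policy S A, M.value π s

/-- Optimal Q-function `Q*`. -/
def optQ (M : MDP S A) (s : S) (a : A) : ℝ :=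
  M.reward s a + M.γ * ∫ s', M.optValue s' ∂(M.trans (s, a))

open Classical in
/-- The set of optimal actions in the state `s`. -/
def optActions [Fintype A] (M : MDP S A) (s : S) : Finset A :=
  Finset.univ.filter fun a => ∀ b, M.optQ s b ≤ M.optQ s a

open Classical in
/-- The optimal policy `π*(a | s)`: uniform on the optimal actions. -/
def optPolicy [Fintype A] (M : MDP S A) (s : S) (a : A) : ℝ :=
  if a ∈ M.optActions s then 1 / ((M.optActions s).card : ℝ) else 0

/-- Law of the next state from `s` under the optimal policy. -/
def optNext [Fintype A] (M : MDP S A) (s : S) : Measure S :=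
  ∑ a, ENNReal.ofReal (M.optPolicy s a) • M.trans (s, a)

/-- `Δ_min(s)`: the largest Q-value in `s` minus the largest Q-value of a suboptimal action
(`+∞` if there is no suboptimal action, the supremum of the empty set being `-∞`). -/
def gapAt [Fintype A] (M : MDP S A) (s : S) : EReal :=
  (⨆ a : A, (M.optQ s a : EReal)) - ⨆ a : {a : A // a ∉ M.optActions s}, (M.optQ s a.1 : EReal)

/-- The minimum gap `Δ_min`. -/
def gap [Fintype A] (M : MDP S A) : EReal := ⨅ s, M.gapAt s

/-! ### Stability -/

/-- First time at which the trajectory visits the set `D` of states (`∞` if it never does). -/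
def hitTime (D : Set S) (ω : ℕ → S × A) : ℝ≥0∞ := ⨅ (k : ℕ) (_ : (ω k).1 ∈ D), (k : ℝ≥0∞)

/-- Stability of the policy `(πₜ)`. The law of the trajectory from time `t` on, given `sₜ = s`,
is that of the trajectory started in `s` under the shifted policy `(π_{t+k})ₖ`. -/
def Stable [Bornology S] (M : MDP S A) (π : ℕ → Policy S A) : Prop :=
  ∀ θ : ℝ, 0 < θ → θ < 1 → ∃ D : Set S, Bornology.IsBounded D ∧ MeasurableSet D ∧
    (∀ s, limsup (fun t : ℕ => M.pathLaw π s {ω | (ω t).1 ∉ D}) atTop ≤ ENNReal.ofReal θ) ∧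
    (∀ s, ⨆ t : ℕ, ∫⁻ ω, hitTime D ω ∂(M.pathLaw (fun k => π (t + k)) s) < ⊤)

/-! ### The sparse-sampling oracle -/

/-- The back-up at a node in state `s` whose sampled children are `c (a, i)`, `i < C`:
`Q̂(s, a) = R(s, a) + γ (1/C) ∑ᵢ V̂(child (a, i))`. -/
def backup (M : MDP S A) (C : ℕ) (s : S) (c : A × Fin C → S × ℝ) (a : A) : ℝ :=
  M.reward s a + M.γ * (1 / (C : ℝ) * ∑ i, (c (a, i)).2)

lemma measurable_backup (M : MDP S A) (C : ℕ) :
    Measurable fun x : S × (A × Fin C → S × ℝ) => M.backup C x.1 x.2 := by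
  refine measurable_pi_lambda _ fun a => ?_
  have h : Measurable fun x : S × (A × Fin C → S × ℝ) => M.reward x.1 a :=
    M.measurable_reward.comp (measurable_fst.prodMk measurable_const)
  unfold backup
  fun_prop

variable [Fintype A] [Nonempty A]

/-- The largest entry of a vector of Q-values. -/
def maxQ (q : A → ℝ) : ℝ := Finset.univ.sup' Finset.univ_nonempty q

lemma measurable_maxQ {A : Type*} [Fintype A] [Nonempty A] : Measurable (maxQ : (A → ℝ) → ℝ) := by
  have h : (maxQ : (A → ℝ) → ℝ) =
      Finset.univ.sup' Finset.univ_nonempty fun (a : A) (q : A → ℝ) => q a := by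
    funext q
    simp [maxQ, Finset.sup'_apply]
  rw [h]
  exact Finset.measurable_sup' _ fun a _ => measurable_pi_apply a

/-- Given the law `κ s'` of the estimated Q-vector of a node in state `s'`: the law of the pair
(state, estimated value) of one sampled child of a node in state `s`, for the action `a`. -/
def childKernel (M : MDP S A) (κ : Kernel S (A → ℝ)) (a : A) : Kernel S (S × ℝ) :=
  M.trans.comap (fun s => (s, a)) (by fun_prop) ⊗ₖ Kernel.prodMkLeft S (κ.map maxQ)

instance (M : MDP S A) (κ : Kernel S (A → ℝ)) [IsMarkovKernel κ] (a : A) :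
    IsMarkovKernel (M.childKernel κ a) := by
  have := Kernel.IsMarkovKernel.map κ (measurable_maxQ (A := A))
  unfold childKernel
  infer_instance

/-- One level of the tree: sample `C` children for each action, independently, together with
independent estimates of their values, and back up. -/
def levelKernel (M : MDP S A) (C : ℕ) (κ : Kernel S (A → ℝ)) [IsMarkovKernel κ] :
    Kernel S (A → ℝ) :=
  (Kernel.id ×ₖ indepKernel fun j : A × Fin C => M.childKernel κ j.1).map
    fun x => M.backup C x.1 x.2

instance (M : MDP S A) (C : ℕ) (κ : Kernel S (A → ℝ)) [IsMarkovKernel κ] :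
    IsMarkovKernel (M.levelKernel C κ) :=
  Kernel.IsMarkovKernel.map _ (M.measurable_backup C)

/-- Law of the estimated Q-vector of a node of the sparse-sampling tree of width `C`, as a function
of the state of the node and of the number of levels below it. Leaves have estimates `0`. -/
def nodeKernel (M : MDP S A) (C : ℕ) : ℕ → {κ : Kernel S (A → ℝ) // IsMarkovKernel κ}
  | 0 => ⟨Kernel.const S (Measure.dirac 0), inferInstance⟩
  | n + 1 =>
    have := (nodeKernel M C n).2
    ⟨M.levelKernel C (nodeKernel M C n).1, inferInstance⟩

/-- The sparse-sampling oracle of width `C` and depth `H`: the law of the estimates `Q̂(s, ·)` it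
returns for the queried state `s`, the root of the tree. -/
def oracle (M : MDP S A) (C H : ℕ) : Kernel S (A → ℝ) := (M.nodeKernel C H).1

instance (M : MDP S A) (C H : ℕ) : IsMarkovKernel (M.oracle C H) := (M.nodeKernel C H).2

/-- Query the oracle afresh in the current state, then draw an action from the Boltzmann
distribution with temperature `τ` over the estimates. -/
def oraclePolicy (M : MDP S A) (C H : ℕ) (τ : ℝ) : Policy S A :=
  ⟨boltzmannKernel A τ ∘ₖ M.oracle C H, inferInstance⟩

/-- Depth of the tree for the accuracy `δ`. -/
def depth (M : MDP S A) (δ : ℝ) : ℕ := ⌈Real.logb M.γ δ⌉₊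

/-- Width of the tree for the accuracy `δ`: the prescribed real number, rounded up to a positive
integer. -/
def width (M : MDP S A) (δ : ℝ) : ℕ :=
  max 1 ⌈2 * M.γ ^ 2 / (δ ^ 2 * (1 - M.γ) ^ 2) *
    (2 * (M.depth δ : ℝ) *
        Real.log (2 * M.γ ^ 2 * (Fintype.card A : ℝ) * (M.depth δ : ℝ) /
          (δ ^ 2 * (1 - M.γ) ^ 2)) +
      Real.log (2 / δ))⌉₊

/-- The threshold `τ(α)` for the temperature. -/
def tauMax (M : MDP S A) (ν α : ℝ) : EReal :=
  min (min (min (Real.sqrt (α / (24 * ν)) : EReal) (((1 - M.γ) / (8 * M.Rmax) : ℝ) : EReal))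
      (((1 - M.γ) * α / (48 * M.Rmax * (Fintype.card A : ℝ) ^ 2 * ν) : ℝ) : EReal))
    (M.gap / (Real.log (24 * ν * (Fintype.card A : ℝ) / α) : EReal))

end MDP

/-! ## The Lyapunov condition -/

/-- `L` is a Lyapunov function for the Markov chain that the optimal policy induces on `S ⊆ ℝᵈ`,
with bounded increments `ν`, `ν'` (under every action) and drift `-α` where `L > B`. -/
structure MDP.IsLyapunov {d : ℕ} {S : Set (EuclideanSpace ℝ (Fin d))} {A : Type*} [Fintype A]
    [MeasurableSpace A] (M : MDP S A) (L : S → ℝ) (ν ν' B α : ℝ) : Prop where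
  measurable : Measurable L
  nonneg : ∀ s, 0 ≤ L s
  tendsto : Tendsto L (comap (fun s : S => ‖(s : EuclideanSpace ℝ (Fin d))‖) atTop) atTop
  sublevel : ∀ ℓ : ℝ,
    BddAbove ((fun s : S => ‖(s : EuclideanSpace ℝ (Fin d))‖) '' {s | L s ≤ ℓ})
  ν_pos : 0 < ν
  ν'_pos : 0 < ν'
  B_pos : 0 < B
  α_pos : 0 < α
  increment : ∀ s a, ∀ᵐ s' ∂(M.trans (s, a)), |L s' - L s| ≤ ν ∧
    ‖(s' : EuclideanSpace ℝ (Fin d)) - (s : EuclideanSpace ℝ (Fin d))‖ ≤ ν'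
  drift : ∀ s, B < L s → ∫ s', (L s' - L s) ∂(M.optNext s) ≤ -α

end StableRL

end

/-! The proof is a Foster–Lyapunov argument for `exp (η * L)`. Because `L` has bounded increments, a
mean drift of at most `-α / 2` where `B < L` becomes, for small `η`, a contraction of `exp (η * L)`
by a factor `r < 1` there; where `L ≤ B` its next mean is bounded (`lintegral_policy_exp_le`). Such
a geometric drift bounds the mean of `exp (η * L)` as time grows, so Markov's inequality controls
the mass outside a high sublevel set of `L`. It also makes the probability of not yet having visited
that set decay geometrically, so the hitting time has finite mean (`stable_of_exp_drift`).

The drift is known only for the optimal policy. Since increments are at most `ν`, half of it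
survives for any policy that gives each action at least `1 - α / (6 * ν)` times its optimal
probability (`sum_policy_mul_meanIncrement_le`). Three losses have to fit into this margin
(`oraclePolicy_real_ge`): failure of the oracle, with probability at most `τ ^ 2`; estimation errors
of order `τ ^ 2`, which the Boltzmann weights amplify by `1 / τ`; and the weight of suboptimal
actions, exponentially small in the gap divided by `τ`.

Accuracy of the oracle (`oracle_inaccurate_le`) is an induction over the levels of the tree. A
back-up contracts the errors of the children by `γ` and adds a sampling error, controlled by
Hoeffding's inequality and a union bound. The comparison with `Q*` needs the Bellman equation for a
`V*` defined as a supremum over policies: the limit of value iteration is a measurable solution, and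
a greedy policy identifies it with `V*` (`optValue_eq_limitValue`). -/

noncomputable section

namespace StableRL.MDP

variable {S A : Type*} [MeasurableSpace S] [MeasurableSpace A]

/-! ## The Markov property of trajectories -/

instance isProbabilityMeasure_pathLaw (M : MDP S A) (π : ℕ → Policy S A) (s : S) :
    IsProbabilityMeasure (M.pathLaw π s) := by
  have : IsProbabilityMeasure (((π 0).1 s).map (Prod.mk s)) :=
    Measure.isProbabilityMeasure_map (by fun_prop)
  unfold pathLaw
  infer_instance

lemma trajMeasure_map_zero {X : ℕ → Type*} [∀ n, MeasurableSpace (X n)] (μ : Measure (X 0))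
    (κ : (n : ℕ) → Kernel (Π i : Finset.Iic n, X i) (X (n + 1))) [∀ n, IsMarkovKernel (κ n)] :
    (Kernel.trajMeasure μ κ).map (fun ω => ω 0) = μ := by
  have h : (fun ω : Π n, X n => ω 0) =
      (fun y : Π i : Finset.Iic 0, X i => y ⟨0, Finset.mem_Iic.2 le_rfl⟩) ∘
        Preorder.frestrictLe 0 := rfl
  rw [h, ← Measure.map_map (by fun_prop) (by fun_prop), Kernel.trajMeasure,
    Measure.map_comp _ _ (by fun_prop), Kernel.traj_map_frestrictLe, Kernel.partialTraj_self,
    Measure.id_comp]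
  exact (Measure.map_map (measurable_pi_apply _) (MeasurableEquiv.measurable _)).trans
    Measure.map_id

lemma lintegral_pathLaw_zero (M : MDP S A) (π : ℕ → Policy S A) (s : S)
    {F : S × A → ℝ≥0∞} (hF : Measurable F) :
    ∫⁻ ω, F (ω 0) ∂(M.pathLaw π s) = ∫⁻ a, F (s, a) ∂((π 0).1 s) := by
  have : IsProbabilityMeasure (((π 0).1 s).map (Prod.mk s)) :=
    Measure.isProbabilityMeasure_map (by fun_prop)
  rw [← lintegral_map hF (measurable_prodMk_left (x := s)),
    ← trajMeasure_map_zero (X := fun _ => S × A) (((π 0).1 s).map (Prod.mk s))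
      (fun n => M.historyKernel (π (n + 1)) n), lintegral_map hF (by fun_prop)]
  rfl

lemma lintegral_stepKernel (M : MDP S A) (π : Policy S A) (x : S × A)
    {F : S × A → ℝ≥0∞} (hF : Measurable F) :
    ∫⁻ y, F y ∂(M.stepKernel π x) = ∫⁻ s', ∫⁻ a', F (s', a') ∂(π.1 s') ∂(M.trans x) := by
  rw [stepKernel, Kernel.lintegral_compProd _ _ _ hF]
  rfl

/-- The Markov property in integrated form. The weight `G` may depend on the whole past, which is
what the survival indicators of the hitting-time estimate require. -/
lemma lintegral_pathLaw_mul_succ (M : MDP S A) (π : ℕ → Policy S A) (s : S) (n : ℕ)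
    {G : (Π _ : Finset.Iic n, S × A) → ℝ≥0∞} (hG : Measurable G)
    {F : S × A → ℝ≥0∞} (hF : Measurable F) :
    ∫⁻ ω, G (Preorder.frestrictLe n ω) * F (ω (n + 1)) ∂(M.pathLaw π s) =
      ∫⁻ ω, G (Preorder.frestrictLe n ω) *
        (∫⁻ s', ∫⁻ a', F (s', a') ∂((π (n + 1)).1 s') ∂(M.trans (ω n))) ∂(M.pathLaw π s) := by
  have : IsProbabilityMeasure (((π 0).1 s).map (Prod.mk s)) :=
    Measure.isProbabilityMeasure_map (by fun_prop)
  have key := Kernel.map_frestrictLe_trajMeasure_compProd_eq_map_trajMeasure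
    (X := fun _ => S × A) (μ₀ := ((π 0).1 s).map (Prod.mk s))
    (κ := fun n => M.historyKernel (π (n + 1)) n) (a := n)
  have hm : Measurable fun z : (Π _ : Finset.Iic n, S × A) × (S × A) => G z.1 * F z.2 := by
    fun_prop
  calc ∫⁻ ω, G (Preorder.frestrictLe n ω) * F (ω (n + 1)) ∂(M.pathLaw π s)
      = ∫⁻ z, G z.1 * F z.2 ∂((M.pathLaw π s).map
          (fun x => (Preorder.frestrictLe (π := fun _ => S × A) n x, x (n + 1)))) := by
        rw [lintegral_map hm (by fun_prop)]
    _ = ∫⁻ h, ∫⁻ y, G h * F y ∂(M.historyKernel (π (n + 1)) n h)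
          ∂((M.pathLaw π s).map (Preorder.frestrictLe (π := fun _ => S × A) n)) := by
        rw [pathLaw, ← key, Measure.lintegral_compProd hm]
    _ = ∫⁻ ω, ∫⁻ y, G (Preorder.frestrictLe n ω) * F y
          ∂(M.historyKernel (π (n + 1)) n (Preorder.frestrictLe n ω)) ∂(M.pathLaw π s) := by
        rw [lintegral_map (hm.lintegral_kernel_prod_right) (by fun_prop)]
    _ = _ := by
        refine lintegral_congr fun ω => ?_
        rw [lintegral_const_mul _ hF, ← lintegral_stepKernel M _ _ hF]
        rfl

lemma measurable_lintegral_policy (π : Policy S A) {F : S × A → ℝ≥0∞} (hF : Measurable F) :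
    Measurable fun s => ∫⁻ a, F (s, a) ∂(π.1 s) :=
  hF.lintegral_kernel_prod_right'

lemma measurable_lintegral_trans (M : MDP S A) {f : S → ℝ≥0∞} (hf : Measurable f) :
    Measurable fun x => ∫⁻ s', f s' ∂(M.trans x) :=
  hf.lintegral_kernel

lemma lintegral_pathLaw_succ (M : MDP S A) (π : ℕ → Policy S A) (s : S) (n : ℕ)
    {F : S × A → ℝ≥0∞} (hF : Measurable F) :
    ∫⁻ ω, F (ω (n + 1)) ∂(M.pathLaw π s) =
      ∫⁻ ω, ∫⁻ s', ∫⁻ a', F (s', a') ∂((π (n + 1)).1 s') ∂(M.trans (ω n)) ∂(M.pathLaw π s) := by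
  simpa using M.lintegral_pathLaw_mul_succ π s n (G := fun _ => 1) measurable_const hF

/-- At each time the action is drawn from the policy in the current state. -/
lemma lintegral_pathLaw_eq_lintegral_policy (M : MDP S A) (π : ℕ → Policy S A) (s : S) (n : ℕ)
    {F : S × A → ℝ≥0∞} (hF : Measurable F) :
    ∫⁻ ω, F (ω n) ∂(M.pathLaw π s) =
      ∫⁻ ω, ∫⁻ a, F ((ω n).1, a) ∂((π n).1 (ω n).1) ∂(M.pathLaw π s) := by
  have hF' : Measurable fun x : S × A => ∫⁻ a, F (x.1, a) ∂((π n).1 x.1) :=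
    (measurable_lintegral_policy (π n) hF).comp measurable_fst
  cases n with
  | zero =>
    rw [M.lintegral_pathLaw_zero π s hF, M.lintegral_pathLaw_zero π s hF']
    simp
  | succ n =>
    rw [M.lintegral_pathLaw_succ π s n hF, M.lintegral_pathLaw_succ π s n hF']
    simp

lemma lintegral_pathLaw_state_succ (M : MDP S A) (π : ℕ → Policy S A) (s : S) (n : ℕ)
    {f : S → ℝ≥0∞} (hf : Measurable f) :
    ∫⁻ ω, f (ω (n + 1)).1 ∂(M.pathLaw π s) =
      ∫⁻ ω, ∫⁻ s', f s' ∂(M.trans (ω n)) ∂(M.pathLaw π s) := by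
  simpa using M.lintegral_pathLaw_succ π s n (F := fun x => f x.1) (by fun_prop)

end StableRL.MDP

namespace StableRL

/-! ## Maxima of Q-vectors -/

section maxQ

variable {A : Type*} [Fintype A] [Nonempty A]

lemma MDP.le_maxQ (q : A → ℝ) (a : A) : q a ≤ MDP.maxQ q :=
  Finset.le_sup' q (Finset.mem_univ a)

lemma MDP.exists_eq_maxQ (q : A → ℝ) : ∃ a, q a = MDP.maxQ q := by
  obtain ⟨a, -, ha⟩ := Finset.exists_mem_eq_sup' (Finset.univ_nonempty (α := A)) q
  exact ⟨a, ha.symm⟩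

lemma MDP.maxQ_le {q : A → ℝ} {c : ℝ} (h : ∀ a, q a ≤ c) : MDP.maxQ q ≤ c :=
  Finset.sup'_le _ _ fun a _ => h a

lemma MDP.maxQ_mono {q q' : A → ℝ} (h : ∀ a, q a ≤ q' a) : MDP.maxQ q ≤ MDP.maxQ q' :=
  MDP.maxQ_le fun a => (h a).trans (MDP.le_maxQ q' a)

lemma MDP.abs_maxQ_sub_maxQ_le {q q' : A → ℝ} {e : ℝ} (h : ∀ a, |q a - q' a| ≤ e) :
    |MDP.maxQ q - MDP.maxQ q'| ≤ e := by
  obtain ⟨a, ha⟩ := MDP.exists_eq_maxQ q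
  obtain ⟨b, hb⟩ := MDP.exists_eq_maxQ q'
  have h1 := abs_le.1 (h a)
  have h2 := abs_le.1 (h b)
  have h3 := MDP.le_maxQ q b
  have h4 := MDP.le_maxQ q' a
  exact abs_le.2 ⟨by linarith, by linarith⟩

end maxQ

namespace MDP

variable {S A : Type*} [MeasurableSpace S] [MeasurableSpace A]

/-! ## The Bellman equation -/

/-- The largest possible value `Rmax / (1 - γ)`. -/
def Vmax (M : MDP S A) : ℝ := M.Rmax / (1 - M.γ)

lemma Vmax_pos (M : MDP S A) : 0 < M.Vmax := div_pos M.Rmax_pos (sub_pos.2 M.γ_lt_one)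

lemma Rmax_add_mul_Vmax (M : MDP S A) : M.Rmax + M.γ * M.Vmax = M.Vmax := by
  have := (sub_pos.2 M.γ_lt_one).ne'
  unfold Vmax
  field_simp
  ring

/-- The one-step look-ahead Q-function of a value function. -/
def lookahead (M : MDP S A) (v : S → ℝ) (s : S) (a : A) : ℝ :=
  M.reward s a + M.γ * ∫ s', v s' ∂(M.trans (s, a))

lemma measurable_lookahead (M : MDP S A) {v : S → ℝ} (hv : Measurable v) :
    Measurable fun x : S × A => M.lookahead v x.1 x.2 :=
  M.measurable_reward.add
    ((StronglyMeasurable.integral_kernel hv.stronglyMeasurable).measurable.const_mul M.γ)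

lemma integrable_of_mem_Icc {μ : Measure S} [IsFiniteMeasure μ] {v : S → ℝ} (hv : Measurable v)
    {c : ℝ} (h : ∀ s, v s ∈ Set.Icc 0 c) : Integrable v μ :=
  Integrable.of_mem_Icc 0 c hv.aemeasurable (ae_of_all _ h)

lemma integral_mem_Icc {μ : Measure S} [IsProbabilityMeasure μ] {v : S → ℝ} (hv : Measurable v)
    {c : ℝ} (h : ∀ s, v s ∈ Set.Icc 0 c) : ∫ s, v s ∂μ ∈ Set.Icc 0 c := by
  refine ⟨integral_nonneg fun s => (h s).1, ?_⟩
  have := integral_mono (integrable_of_mem_Icc (μ := μ) hv h) (integrable_const c)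
    fun s => (h s).2
  simpa using this

lemma lookahead_mem_Icc (M : MDP S A) {v : S → ℝ} (hv : Measurable v)
    (h : ∀ s, v s ∈ Set.Icc 0 M.Vmax) (s : S) (a : A) :
    M.lookahead v s a ∈ Set.Icc 0 M.Vmax := by
  have h1 := integral_mem_Icc (μ := M.trans (s, a)) hv h
  have h2 := M.reward_nonneg s a
  have h3 := M.reward_le s a
  have h4 := M.Rmax_add_mul_Vmax
  have h5 := mul_nonneg M.γ_pos.le h1.1
  have h6 := mul_le_mul_of_nonneg_left h1.2 M.γ_pos.le
  unfold lookahead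
  constructor <;> linarith

/-- Rewards are nonnegative, so Tonelli applies in `ℝ≥0∞` and the verification argument below can
avoid integrability questions. -/
lemma value_eq_toReal (M : MDP S A) (π : Policy S A) (s : S) :
    M.value π s = (∑' t : ℕ, ENNReal.ofReal (M.γ ^ t) *
      ∫⁻ ω, ENNReal.ofReal (M.reward (ω t).1 (ω t).2) ∂(M.pathLaw (fun _ => π) s)).toReal := by
  have hm (t : ℕ) : Measurable fun ω : ℕ → S × A => M.reward (ω t).1 (ω t).2 :=
    M.measurable_reward.comp (measurable_pi_apply t)
  have hnn (t : ℕ) (ω : ℕ → S × A) : 0 ≤ M.γ ^ t * M.reward (ω t).1 (ω t).2 :=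
    mul_nonneg (pow_nonneg M.γ_pos.le t) (M.reward_nonneg _ _)
  have hs (ω : ℕ → S × A) : Summable fun t => M.γ ^ t * M.reward (ω t).1 (ω t).2 :=
    Summable.of_nonneg_of_le (fun t => hnn t ω)
      (fun t => mul_le_mul_of_nonneg_left (M.reward_le _ _) (pow_nonneg M.γ_pos.le t))
      ((summable_geometric_of_lt_one M.γ_pos.le M.γ_lt_one).mul_right M.Rmax)
  have htm : Measurable fun ω : ℕ → S × A => ∑' t : ℕ, M.γ ^ t * M.reward (ω t).1 (ω t).2 :=
    Measurable.tsum fun t => (hm t).const_mul _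
  rw [value, integral_eq_lintegral_of_nonneg_ae
    (ae_of_all _ fun ω => tsum_nonneg fun t => hnn t ω) htm.aestronglyMeasurable]
  congr 1
  simp_rw [fun ω => ENNReal.ofReal_tsum_of_nonneg (fun t => hnn t ω) (hs ω)]
  rw [lintegral_tsum fun t => ((hm t).const_mul _).ennreal_ofReal.aemeasurable]
  refine tsum_congr fun t => ?_
  simp_rw [ENNReal.ofReal_mul (pow_nonneg M.γ_pos.le t)]
  exact lintegral_const_mul _ (hm t).ennreal_ofReal

lemma ofReal_lookahead (M : MDP S A) {v : S → ℝ} (hv : Measurable v) {c : ℝ}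
    (h : ∀ s, v s ∈ Set.Icc 0 c) (x : S × A) :
    ENNReal.ofReal (M.lookahead v x.1 x.2) = ENNReal.ofReal (M.reward x.1 x.2) +
      ENNReal.ofReal M.γ * ∫⁻ s', ENNReal.ofReal (v s') ∂(M.trans x) := by
  rw [lookahead, ENNReal.ofReal_add (M.reward_nonneg _ _)
    (mul_nonneg M.γ_pos.le (integral_nonneg fun s' => (h s').1)), ENNReal.ofReal_mul M.γ_pos.le,
    ofReal_integral_eq_lintegral_ofReal (integrable_of_mem_Icc hv h)
      (ae_of_all _ fun s' => (h s').1)]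

/-- Telescoping of the look-ahead along a trajectory. -/
lemma lintegral_lookahead_pathLaw (M : MDP S A) (π : Policy S A) (s : S) {v : S → ℝ}
    (hv : Measurable v) {c : ℝ} (h : ∀ s, v s ∈ Set.Icc 0 c) (t : ℕ) :
    ∫⁻ ω, ENNReal.ofReal (M.lookahead v (ω t).1 (ω t).2) ∂(M.pathLaw (fun _ => π) s) =
      ∫⁻ ω, ENNReal.ofReal (M.reward (ω t).1 (ω t).2) ∂(M.pathLaw (fun _ => π) s) +
      ENNReal.ofReal M.γ * ∫⁻ ω, ENNReal.ofReal (v (ω (t + 1)).1) ∂(M.pathLaw (fun _ => π) s) := by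
  have hm : Measurable fun ω : ℕ → S × A => M.reward (ω t).1 (ω t).2 :=
    M.measurable_reward.comp (measurable_pi_apply t)
  have hm2 : Measurable fun ω : ℕ → S × A => ∫⁻ s', ENNReal.ofReal (v s') ∂(M.trans (ω t)) :=
    (M.measurable_lintegral_trans hv.ennreal_ofReal).comp (measurable_pi_apply t)
  simp_rw [M.ofReal_lookahead hv h]
  rw [lintegral_add_left hm.ennreal_ofReal, lintegral_const_mul _ hm2,
    ← M.lintegral_pathLaw_state_succ (fun _ => π) s t hv.ennreal_ofReal]

lemma ofReal_pow_succ_mul (M : MDP S A) (n : ℕ) (x : ℝ≥0∞) :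
    ENNReal.ofReal (M.γ ^ (n + 1)) * x =
      ENNReal.ofReal (M.γ ^ n) * (ENNReal.ofReal M.γ * x) := by
  rw [pow_succ, ENNReal.ofReal_mul (pow_nonneg M.γ_pos.le n), mul_assoc]

variable [Fintype A] [Nonempty A]

/-- Value iteration, started at `0`. -/
def valueIter (M : MDP S A) : ℕ → S → ℝ
  | 0 => fun _ => 0
  | n + 1 => fun s => maxQ (M.lookahead (M.valueIter n) s)

lemma measurable_valueIter (M : MDP S A) (n : ℕ) : Measurable (M.valueIter n) := by
  induction n with
  | zero => exact measurable_const
  | succ n ih =>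
    refine measurable_maxQ.comp (measurable_pi_lambda _ fun a => ?_)
    exact (M.measurable_lookahead ih).comp (measurable_prodMk_right (y := a))

lemma valueIter_mem_Icc (M : MDP S A) (n : ℕ) (s : S) : M.valueIter n s ∈ Set.Icc 0 M.Vmax := by
  induction n generalizing s with
  | zero => exact ⟨le_rfl, M.Vmax_pos.le⟩
  | succ n ih =>
    obtain ⟨a, ha⟩ := exists_eq_maxQ (M.lookahead (M.valueIter n) s)
    change maxQ _ ∈ _
    rw [← ha]
    exact M.lookahead_mem_Icc (M.measurable_valueIter n) ih s a

lemma monotone_valueIter (M : MDP S A) (s : S) : Monotone fun n => M.valueIter n s := by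
  refine monotone_nat_of_le_succ fun n => ?_
  induction n generalizing s with
  | zero => exact (M.valueIter_mem_Icc 1 s).1
  | succ n ih =>
    refine maxQ_mono fun a => ?_
    have hi (k : ℕ) : Integrable (M.valueIter k) (M.trans (s, a)) :=
      integrable_of_mem_Icc (M.measurable_valueIter k) (M.valueIter_mem_Icc k)
    have := mul_le_mul_of_nonneg_left (integral_mono (hi n) (hi (n + 1)) ih) M.γ_pos.le
    unfold lookahead
    linarith

/-- The limit of value iteration. -/
def limitValue (M : MDP S A) (s : S) : ℝ := ⨆ n, M.valueIter n s

lemma bddAbove_range_valueIter (M : MDP S A) (s : S) :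
    BddAbove (Set.range fun n => M.valueIter n s) :=
  ⟨M.Vmax, by rintro _ ⟨n, rfl⟩; exact (M.valueIter_mem_Icc n s).2⟩

lemma tendsto_valueIter (M : MDP S A) (s : S) :
    Tendsto (fun n => M.valueIter n s) atTop (nhds (M.limitValue s)) :=
  tendsto_atTop_ciSup (M.monotone_valueIter s) (M.bddAbove_range_valueIter s)

lemma measurable_limitValue (M : MDP S A) : Measurable M.limitValue :=
  measurable_of_tendsto_metrizable M.measurable_valueIter
    (tendsto_pi_nhds.2 M.tendsto_valueIter)

lemma limitValue_mem_Icc (M : MDP S A) (s : S) : M.limitValue s ∈ Set.Icc 0 M.Vmax :=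
  isClosed_Icc.mem_of_tendsto (M.tendsto_valueIter s)
    (Eventually.of_forall fun n => M.valueIter_mem_Icc n s)

lemma tendsto_lookahead_valueIter (M : MDP S A) (s : S) (a : A) :
    Tendsto (fun n => M.lookahead (M.valueIter n) s a) atTop
      (nhds (M.lookahead M.limitValue s a)) := by
  refine tendsto_const_nhds.add (Tendsto.const_mul _ ?_)
  refine tendsto_integral_of_dominated_convergence (fun _ => M.Vmax)
    (fun n => (M.measurable_valueIter n).aestronglyMeasurable) (integrable_const _)
    (fun n => ae_of_all _ fun s' => ?_) (ae_of_all _ M.tendsto_valueIter)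
  have := M.valueIter_mem_Icc n s'
  rw [Real.norm_eq_abs, abs_of_nonneg this.1]
  exact this.2

/-- The limit of value iteration solves the Bellman equation. -/
lemma limitValue_eq_maxQ (M : MDP S A) (s : S) :
    M.limitValue s = maxQ (M.lookahead M.limitValue s) := by
  have h1 := (tendsto_add_atTop_iff_nat 1).2 (M.tendsto_valueIter s)
  refine tendsto_nhds_unique h1 ?_
  have h2 : (fun n => M.valueIter (n + 1) s) =
      fun n => Finset.univ.sup' Finset.univ_nonempty (M.lookahead (M.valueIter n) s) := rfl
  rw [h2]
  exact Tendsto.finset_sup'_nhds_apply Finset.univ_nonempty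
    fun a _ => M.tendsto_lookahead_valueIter s a

lemma lintegral_limitValue_zero (M : MDP S A) (π : Policy S A) (s : S) :
    ∫⁻ ω, ENNReal.ofReal (M.limitValue (ω 0).1) ∂(M.pathLaw (fun _ => π) s) =
      ENNReal.ofReal (M.limitValue s) := by
  rw [M.lintegral_pathLaw_zero (fun _ => π) s (F := fun x => ENNReal.ofReal (M.limitValue x.1))
    (M.measurable_limitValue.comp measurable_fst).ennreal_ofReal]
  simp

/-- The discounted reward collected up to time `n`, plus the discounted `limitValue` of the state
reached, is nonincreasing in `n`, because `limitValue` dominates its look-ahead for every action. At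
`n = 0` it equals `limitValue s`. -/
lemma sum_reward_le_limitValue (M : MDP S A) (π : Policy S A) (s : S) :
    ∑' t : ℕ, ENNReal.ofReal (M.γ ^ t) *
      ∫⁻ ω, ENNReal.ofReal (M.reward (ω t).1 (ω t).2) ∂(M.pathLaw (fun _ => π) s) ≤
      ENNReal.ofReal (M.limitValue s) := by
  refine ENNReal.tsum_le_of_sum_range_le fun n => ?_
  suffices h : ∑ t ∈ Finset.range n, ENNReal.ofReal (M.γ ^ t) *
      ∫⁻ ω, ENNReal.ofReal (M.reward (ω t).1 (ω t).2) ∂(M.pathLaw (fun _ => π) s) +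
      ENNReal.ofReal (M.γ ^ n) *
        ∫⁻ ω, ENNReal.ofReal (M.limitValue (ω n).1) ∂(M.pathLaw (fun _ => π) s) ≤
      ENNReal.ofReal (M.limitValue s) from le_self_add.trans h
  induction n with
  | zero => simp [lintegral_limitValue_zero]
  | succ n ih =>
    refine le_trans ?_ ih
    rw [Finset.sum_range_succ, add_assoc, M.ofReal_pow_succ_mul, ← mul_add,
      ← M.lintegral_lookahead_pathLaw π s M.measurable_limitValue M.limitValue_mem_Icc]
    gcongr with ω
    conv_rhs => rw [M.limitValue_eq_maxQ]
    exact le_maxQ _ _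

lemma value_le_limitValue (M : MDP S A) (π : Policy S A) (s : S) :
    M.value π s ≤ M.limitValue s := by
  rw [value_eq_toReal]
  exact ENNReal.toReal_le_of_le_ofReal (M.limitValue_mem_Icc s).1 (M.sum_reward_le_limitValue π s)

/-- Ties are broken by an enumeration of the actions: taking the first index that attains the
maximum is a measurable selection. -/
lemma exists_measurable_greedy (M : MDP S A) :
    ∃ g : S → A, Measurable g ∧ ∀ s, M.lookahead M.limitValue s (g s) = M.limitValue s := by
  classical
  obtain ⟨e, he⟩ := exists_surjective_nat A
  have hex (s : S) : ∃ n, M.lookahead M.limitValue s (e n) = M.limitValue s := by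
    obtain ⟨a, ha⟩ := exists_eq_maxQ (M.lookahead M.limitValue s)
    obtain ⟨n, rfl⟩ := he a
    exact ⟨n, ha.trans (M.limitValue_eq_maxQ s).symm⟩
  refine ⟨fun s => e (Nat.find (hex s)), ?_, fun s => Nat.find_spec (hex s)⟩
  refine Measurable.find (f := fun n _ => e n) (fun n => measurable_const) (fun n => ?_) hex
  exact measurableSet_eq_fun
    ((M.measurable_lookahead M.measurable_limitValue).comp (measurable_prodMk_right (y := e n)))
    M.measurable_limitValue

variable [DiscreteMeasurableSpace A]

/-- Under a greedy policy the telescoping inequality becomes an equality, and its remainder after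
`n` steps is at most `M.γ ^ n * M.Vmax`, which vanishes in the limit. -/
lemma exists_value_eq_limitValue (M : MDP S A) :
    ∃ π : Policy S A, ∀ s, M.value π s = M.limitValue s := by
  obtain ⟨g, hg, hgW⟩ := M.exists_measurable_greedy
  refine ⟨⟨Kernel.deterministic g hg, inferInstance⟩, fun s => ?_⟩
  set π : Policy S A := ⟨Kernel.deterministic g hg, inferInstance⟩ with hπ
  refine le_antisymm (M.value_le_limitValue π s) ?_
  set r : ℕ → ℝ≥0∞ := fun t =>
    ∫⁻ ω, ENNReal.ofReal (M.reward (ω t).1 (ω t).2) ∂(M.pathLaw (fun _ => π) s) with hr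
  set w : ℕ → ℝ≥0∞ := fun t =>
    ∫⁻ ω, ENNReal.ofReal (M.limitValue (ω t).1) ∂(M.pathLaw (fun _ => π) s) with hw
  have hstep (t : ℕ) : w t = r t + ENNReal.ofReal M.γ * w (t + 1) := by
    rw [hr, hw, ← M.lintegral_lookahead_pathLaw π s M.measurable_limitValue M.limitValue_mem_Icc,
      M.lintegral_pathLaw_eq_lintegral_policy (fun _ => π) s t
      (F := fun x => ENNReal.ofReal (M.lookahead M.limitValue x.1 x.2))
      (M.measurable_lookahead M.measurable_limitValue).ennreal_ofReal]
    refine lintegral_congr fun ω => ?_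
    have hma : Measurable fun a => ENNReal.ofReal (M.lookahead M.limitValue (ω t).1 a) :=
      measurable_of_countable _
    simp only [hπ]
    rw [Kernel.deterministic_apply, lintegral_dirac' _ hma, hgW]
  have hsum (n : ℕ) : ENNReal.ofReal (M.limitValue s) =
      ∑ t ∈ Finset.range n, ENNReal.ofReal (M.γ ^ t) * r t + ENNReal.ofReal (M.γ ^ n) * w n := by
    induction n with
    | zero => simp [hw, lintegral_limitValue_zero]
    | succ n ih =>
      rw [ih, Finset.sum_range_succ, add_assoc, M.ofReal_pow_succ_mul, ← mul_add, ← hstep]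
  have hle (n : ℕ) : M.limitValue s ≤ M.value π s + M.γ ^ n * M.Vmax := by
    have hwn : w n ≤ ENNReal.ofReal M.Vmax :=
      (lintegral_mono fun ω => ENNReal.ofReal_le_ofReal (M.limitValue_mem_Icc _).2).trans
        (by simp)
    have hfin := ne_top_of_le_ne_top ENNReal.ofReal_ne_top (M.sum_reward_le_limitValue π s)
    have h0 : 0 ≤ M.value π s := by rw [value_eq_toReal]; exact ENNReal.toReal_nonneg
    rw [← ENNReal.ofReal_le_ofReal_iff (add_nonneg h0
        (mul_nonneg (pow_nonneg M.γ_pos.le n) M.Vmax_pos.le)),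
      ENNReal.ofReal_add h0 (mul_nonneg (pow_nonneg M.γ_pos.le n) M.Vmax_pos.le),
      ENNReal.ofReal_mul (pow_nonneg M.γ_pos.le n), hsum n, value_eq_toReal,
      ENNReal.ofReal_toReal hfin]
    gcongr
    exact ENNReal.sum_le_tsum _
  refine ge_of_tendsto' (b := M.limitValue s)
    (f := fun n => M.value π s + M.γ ^ n * M.Vmax) (x := atTop) ?_ hle
  simpa using tendsto_const_nhds.add
    ((tendsto_pow_atTop_nhds_zero_of_lt_one M.γ_pos.le M.γ_lt_one).mul_const M.Vmax)

/-- Besides the Bellman equation, this yields measurability of `V*`, which is not evident for a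
supremum over all policies. -/
lemma optValue_eq_limitValue (M : MDP S A) : M.optValue = M.limitValue := by
  funext s
  obtain ⟨π, hπ⟩ := M.exists_value_eq_limitValue
  have : Nonempty (Policy S A) := ⟨π⟩
  refine le_antisymm (ciSup_le fun π' => M.value_le_limitValue π' s) ?_
  rw [← hπ s]
  exact le_ciSup (f := fun π' => M.value π' s)
    ⟨M.limitValue s, by rintro _ ⟨π', rfl⟩; exact M.value_le_limitValue π' s⟩ π

lemma measurable_optValue (M : MDP S A) : Measurable M.optValue := by
  rw [optValue_eq_limitValue]; exact M.measurable_limitValue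

lemma optValue_mem_Icc (M : MDP S A) (s : S) : M.optValue s ∈ Set.Icc 0 M.Vmax := by
  rw [optValue_eq_limitValue]; exact M.limitValue_mem_Icc s

/-- The Bellman optimality equation `V*(s) = max_a Q*(s, a)`. -/
lemma optValue_eq_maxQ (M : MDP S A) (s : S) : M.optValue s = maxQ (M.optQ s) := by
  have h : M.optQ s = M.lookahead M.limitValue s := by
    funext a
    rw [optQ, lookahead, optValue_eq_limitValue]
  rw [h, optValue_eq_limitValue]
  exact M.limitValue_eq_maxQ s

lemma optQ_mem_Icc (M : MDP S A) (s : S) (a : A) : M.optQ s a ∈ Set.Icc 0 M.Vmax :=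
  M.lookahead_mem_Icc M.measurable_optValue M.optValue_mem_Icc s a

end StableRL.MDP

namespace StableRL

/-! ## Accuracy of the sparse-sampling oracle -/

/-- Two-sided Hoeffding inequality for the average of independent variables in `[0, c]`. -/
lemma measureReal_abs_average_sub_gt_le {Ω : Type*} [MeasurableSpace Ω] {μ : Measure Ω}
    [IsProbabilityMeasure μ] {C : ℕ} (hC : 0 < C) {X : Fin C → Ω → ℝ} (hX : ∀ i, Measurable (X i))
    (hind : iIndepFun X μ) {c : ℝ} (hb : ∀ i ω, X i ω ∈ Set.Icc 0 c) (hc : 0 < c)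
    {m : ℝ} (hm : ∀ i, μ[X i] = m) {l : ℝ} (hl : 0 ≤ l) :
    μ.real {ω | l < |1 / (C : ℝ) * ∑ i, X i ω - m|} ≤
      2 * Real.exp (-(2 * C * l ^ 2 / c ^ 2)) := by
  have hC' : (0 : ℝ) < C := Nat.cast_pos.2 hC
  have hsub (i : Fin C) : HasSubgaussianMGF (fun ω => X i ω - m) ((‖c - 0‖₊ / 2) ^ 2) μ := by
    rw [← hm i]
    exact hasSubgaussianMGF_of_mem_Icc (hX i).aemeasurable (ae_of_all _ (hb i))
  have hind1 : iIndepFun (fun i ω => X i ω - m) μ :=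
    hind.comp (fun _ x => x - m) fun _ => by fun_prop
  have hind2 : iIndepFun (fun i => -fun ω => X i ω - m) μ :=
    hind.comp (fun _ x => -(x - m)) fun _ => by fun_prop
  have h1 := HasSubgaussianMGF.measure_sum_ge_le_of_iIndepFun hind1 (s := Finset.univ)
    (fun i _ => hsub i) (mul_nonneg hC'.le hl)
  have h2 := HasSubgaussianMGF.measure_sum_ge_le_of_iIndepFun hind2 (s := Finset.univ)
    (fun i _ => (hsub i).neg) (mul_nonneg hC'.le hl)
  have hexp : -((C : ℝ) * l) ^ 2 /
      (2 * ((∑ _i : Fin C, (‖c - 0‖₊ / 2) ^ 2 : NNReal) : ℝ)) = -(2 * C * l ^ 2 / c ^ 2) := by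
    simp only [sub_zero, Finset.sum_const, Finset.card_univ, Fintype.card_fin, nsmul_eq_mul,
      NNReal.coe_mul, NNReal.coe_natCast, NNReal.coe_pow, NNReal.coe_div, coe_nnnorm,
      Real.norm_eq_abs, NNReal.coe_ofNat, abs_of_pos hc]
    field_simp
  rw [hexp] at h1 h2
  calc μ.real {ω | l < |1 / (C : ℝ) * ∑ i, X i ω - m|}
      ≤ μ.real ({ω | (C : ℝ) * l ≤ ∑ i, (X i ω - m)} ∪
          {ω | (C : ℝ) * l ≤ ∑ i, (-fun ω => X i ω - m) ω}) := by
        refine measureReal_mono (fun ω hω => ?_)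
        simp only [Set.mem_ofPred_eq, Set.mem_union, Pi.neg_apply, Finset.sum_neg_distrib,
          Finset.sum_sub_distrib, Finset.sum_const, Finset.card_univ, Fintype.card_fin,
          nsmul_eq_mul] at hω ⊢
        have heq : ∑ i, X i ω - C * m = C * (1 / (C : ℝ) * ∑ i, X i ω - m) := by
          field_simp
        rw [heq, ← mul_neg]
        rcases lt_abs.1 hω with h | h
        · exact Or.inl (mul_le_mul_of_nonneg_left h.le hC'.le)
        · exact Or.inr (mul_le_mul_of_nonneg_left h.le hC'.le)
    _ ≤ _ := (measureReal_union_le _ _).trans (by linarith)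

namespace MDP

variable {S A : Type*} [MeasurableSpace S] [MeasurableSpace A]
-- The error splits into the fluctuation of the average of the true `V*` at the sampled states and
-- the errors of the children's own estimates.
lemma abs_backup_sub_optQ_le (M : MDP S A) {C : ℕ} (hC : 0 < C) {l e : ℝ}
    (s : S) (c : A × Fin C → S × ℝ) (a : A)
    (h1 : |1 / (C : ℝ) * ∑ i, M.optValue (c (a, i)).1 - ∫ s', M.optValue s' ∂(M.trans (s, a))| ≤ l)
    (h2 : ∀ i, |(c (a, i)).2 - M.optValue (c (a, i)).1| ≤ e) :
    |M.backup C s c a - M.optQ s a| ≤ M.γ * (l + e) := by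
  have hC' : (0 : ℝ) < C := Nat.cast_pos.2 hC
  have h3 : |1 / (C : ℝ) * ∑ i, ((c (a, i)).2 - M.optValue (c (a, i)).1)| ≤ e := by
    rw [abs_mul, abs_of_pos (by positivity : 0 < 1 / (C : ℝ)), one_div, inv_mul_le_iff₀ hC']
    refine (Finset.abs_sum_le_sum_abs _ _).trans ?_
    simpa using Finset.sum_le_card_nsmul Finset.univ _ e fun i _ => h2 i
  have heq : M.backup C s c a - M.optQ s a =
      M.γ * ((1 / (C : ℝ) * ∑ i, M.optValue (c (a, i)).1 -
        ∫ s', M.optValue s' ∂(M.trans (s, a))) +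
        1 / (C : ℝ) * ∑ i, ((c (a, i)).2 - M.optValue (c (a, i)).1)) := by
    rw [backup, optQ, Finset.sum_sub_distrib]
    ring
  rw [heq, abs_mul, abs_of_pos M.γ_pos]
  exact mul_le_mul_of_nonneg_left ((abs_add_le _ _).trans (add_le_add h1 h3)) M.γ_pos.le

variable [Fintype A]

/-- The event that some estimate in `q` is off by more than `e` in the state `s`. -/
def inaccurate (M : MDP S A) (e : ℝ) (s : S) : Set (A → ℝ) := {q | ∃ a, e < |q a - M.optQ s a|}

lemma measurableSet_inaccurate (M : MDP S A) (e : ℝ) (s : S) :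
    MeasurableSet (M.inaccurate e s) := by
  have : M.inaccurate e s = ⋃ a, {q | e < |q a - M.optQ s a|} := by
    ext q
    simp [inaccurate]
  rw [this]
  exact MeasurableSet.iUnion fun a => measurableSet_lt measurable_const (by fun_prop)

variable [Nonempty A]

lemma levelKernel_apply (M : MDP S A) (C : ℕ) (κ : Kernel S (A → ℝ)) [IsMarkovKernel κ] (s : S) :
    M.levelKernel C κ s =
      (indepKernel (fun j : A × Fin C => M.childKernel κ j.1) s).map (M.backup C s) := by
  rw [levelKernel, Kernel.map_apply _ (M.measurable_backup C), Kernel.prod_apply, Kernel.id_apply,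
    Measure.dirac_prod, Measure.map_map (M.measurable_backup C) measurable_prodMk_left]
  rfl

lemma map_childKernel_fst (M : MDP S A) (κ : Kernel S (A → ℝ)) [IsMarkovKernel κ] (a : A)
    (s : S) : (M.childKernel κ a s).map Prod.fst = M.trans (s, a) := by
  have := Kernel.IsMarkovKernel.map κ (measurable_maxQ (A := A))
  rw [← Kernel.map_apply _ measurable_fst, ← Kernel.fst_eq, childKernel, Kernel.fst_compProd,
    Kernel.comap_apply]

variable [DiscreteMeasurableSpace A]

/-- The sampled values of the children of a node, averaged for each action, are close to the
expected values, but with probability `h`. -/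
def SampleAccurate (M : MDP S A) (C : ℕ) (l h : ℝ) : Prop :=
  ∀ (κ : Kernel S (A → ℝ)) [IsMarkovKernel κ] (s : S) (a : A),
    indepKernel (fun j : A × Fin C => M.childKernel κ j.1) s
      {c | l < |1 / (C : ℝ) * ∑ i, M.optValue (c (a, i)).1 -
        ∫ s', M.optValue s' ∂(M.trans (s, a))|} ≤ ENNReal.ofReal h

/-- Average and mean both lie in `[0, Vmax]`. This deterministic bound suffices when the accuracy
sought is coarse. -/
lemma sampleAccurate_Vmax (M : MDP S A) {C : ℕ} (hC : 0 < C) : M.SampleAccurate C M.Vmax 0 := by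
  intro κ _ s a
  have hC' : (0 : ℝ) < C := Nat.cast_pos.2 hC
  have : {c : A × Fin C → S × ℝ | M.Vmax < |1 / (C : ℝ) * ∑ i, M.optValue (c (a, i)).1 -
      ∫ s', M.optValue s' ∂(M.trans (s, a))|} = ∅ := by
    refine Set.eq_empty_of_forall_notMem fun c hc => ?_
    have h1 := integral_mem_Icc (μ := M.trans (s, a)) M.measurable_optValue M.optValue_mem_Icc
    have h2 : 0 ≤ 1 / (C : ℝ) * ∑ i, M.optValue (c (a, i)).1 :=
      mul_nonneg (by positivity) (Finset.sum_nonneg fun i _ => (M.optValue_mem_Icc _).1)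
    have h3 : 1 / (C : ℝ) * ∑ i, M.optValue (c (a, i)).1 ≤ M.Vmax := by
      have := Finset.sum_le_card_nsmul Finset.univ (fun i => M.optValue (c (a, i)).1) M.Vmax
        fun i _ => (M.optValue_mem_Icc _).2
      rw [Finset.card_univ, Fintype.card_fin, nsmul_eq_mul] at this
      rw [one_div, inv_mul_le_iff₀ hC']
      exact this
    rw [Set.mem_ofPred_eq] at hc
    refine absurd hc (not_lt.2 (abs_le.2 ⟨?_, ?_⟩))
    · linarith [h1.2]
    · linarith [h1.1]
  rw [this]
  simp

/-- Only the sampled states enter: for a fixed action they are `C` independent draws from `trans (s,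
a)`, whatever the kernel `κ` of the estimates attached to them. -/
lemma sampleAccurate_hoeffding (M : MDP S A) {C : ℕ} (hC : 0 < C) {l : ℝ} (hl : 0 ≤ l) :
    M.SampleAccurate C l (2 * Real.exp (-(2 * C * l ^ 2 / M.Vmax ^ 2))) := by
  intro κ _ s a
  set μ : Measure (A × Fin C → S × ℝ) := Measure.pi fun j => M.childKernel κ j.1 s with hμ
  change μ _ ≤ _
  have hind : iIndepFun (fun (i : Fin C) (c : A × Fin C → S × ℝ) => M.optValue (c (a, i)).1) μ :=
    (iIndepFun_pi (μ := fun j : A × Fin C => M.childKernel κ j.1 s)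
      (X := fun _ x => M.optValue x.1)
      fun _ => (M.measurable_optValue.comp measurable_fst).aemeasurable).precomp
        (g := fun i : Fin C => (a, i)) (Prod.mk_right_injective a)
  have hX (i : Fin C) : Measurable fun c : A × Fin C → S × ℝ => M.optValue (c (a, i)).1 :=
    M.measurable_optValue.comp (measurable_fst.comp (measurable_pi_apply _))
  have hm (i : Fin C) : ∫ c, M.optValue (c (a, i)).1 ∂μ =
      ∫ s', M.optValue s' ∂(M.trans (s, a)) := by
    have h1 : μ.map (fun c => (c (a, i)).1) = M.trans (s, a) := by
      rw [← M.map_childKernel_fst κ a s, ← (measurePreserving_eval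
        (fun j : A × Fin C => M.childKernel κ j.1 s) (a, i)).map_eq,
        Measure.map_map measurable_fst (measurable_pi_apply _)]
      rfl
    have h2 : Measurable fun c : A × Fin C → S × ℝ => (c (a, i)).1 :=
      measurable_fst.comp (measurable_pi_apply _)
    rw [← h1, integral_map h2.aemeasurable M.measurable_optValue.aestronglyMeasurable]
  rw [← ENNReal.ofReal_toReal (measure_ne_top μ _)]
  exact ENNReal.ofReal_le_ofReal (measureReal_abs_average_sub_gt_le hC hX hind
    (fun i ω => M.optValue_mem_Icc _) M.Vmax_pos hm hl)

/-- The maximum is 1-Lipschitz in the sup norm, so an accurate Q-vector gives an accurate value by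
the Bellman equation. -/
lemma childKernel_inaccurate_le (M : MDP S A) (κ : Kernel S (A → ℝ)) [IsMarkovKernel κ]
    {e : ℝ} {p : ℝ≥0∞} (h : ∀ s, κ s (M.inaccurate e s) ≤ p) (s : S) (a : A) :
    M.childKernel κ a s {x | e < |x.2 - M.optValue x.1|} ≤ p := by
  have := Kernel.IsMarkovKernel.map κ (measurable_maxQ (A := A))
  have hms : MeasurableSet {x : S × ℝ | e < |x.2 - M.optValue x.1|} :=
    measurableSet_lt measurable_const
      (measurable_snd.sub (M.measurable_optValue.comp measurable_fst)).abs
  rw [childKernel, Kernel.compProd_apply hms]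
  calc ∫⁻ s', _ ∂_ ≤ ∫⁻ _, p ∂(M.trans.comap (fun s => (s, a)) (by fun_prop) s) := by
        refine lintegral_mono fun s' => ?_
        change (κ.map maxQ) s' _ ≤ p
        rw [Kernel.map_apply' _ measurable_maxQ _ (measurable_prodMk_left hms)]
        refine (measure_mono fun q hq => ?_).trans (h s')
        by_contra hcon
        simp only [inaccurate, Set.mem_ofPred_eq, not_exists, not_lt] at hcon
        have h1 : e < |maxQ q - M.optValue s'| := hq
        rw [M.optValue_eq_maxQ] at h1
        exact absurd h1 (not_lt.2 (abs_maxQ_sub_maxQ_le hcon))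
    _ = p := by simp

/-- Union bound over the `|A|` averages and the `|A| * C` children. -/
lemma levelKernel_inaccurate_le (M : MDP S A) {C : ℕ} (hC : 0 < C) (κ : Kernel S (A → ℝ))
    [IsMarkovKernel κ] {l h e p : ℝ} (hacc : M.SampleAccurate C l h)
    (hκ : ∀ s, κ s (M.inaccurate e s) ≤ ENNReal.ofReal p) (hh : 0 ≤ h) (hp : 0 ≤ p) (s : S) :
    M.levelKernel C κ s (M.inaccurate (M.γ * (l + e)) s) ≤
      ENNReal.ofReal (Fintype.card A * h + Fintype.card A * C * p) := by
  have hmb : Measurable (M.backup C s) := (M.measurable_backup C).comp measurable_prodMk_left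
  rw [levelKernel_apply, Measure.map_apply hmb (M.measurableSet_inaccurate _ _)]
  set μ := indepKernel (fun j : A × Fin C => M.childKernel κ j.1) s with hμ
  have hms : MeasurableSet {x : S × ℝ | e < |x.2 - M.optValue x.1|} :=
    measurableSet_lt measurable_const
      (measurable_snd.sub (M.measurable_optValue.comp measurable_fst)).abs
  have hsub : M.backup C s ⁻¹' M.inaccurate (M.γ * (l + e)) s ⊆
      (⋃ a, {c | l < |1 / (C : ℝ) * ∑ i, M.optValue (c (a, i)).1 -
        ∫ s', M.optValue s' ∂(M.trans (s, a))|}) ∪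
      ⋃ j, (fun c => c j) ⁻¹' {x : S × ℝ | e < |x.2 - M.optValue x.1|} := by
    rintro c ⟨a, ha⟩
    by_contra hcon
    simp only [Set.mem_union, Set.mem_iUnion, Set.mem_ofPred_eq, Set.mem_preimage, not_or,
      not_exists, not_lt] at hcon
    exact absurd ha (not_lt.2 (M.abs_backup_sub_optQ_le hC s c a (hcon.1 a) fun i => hcon.2 (a, i)))
  have hchild (j : A × Fin C) :
      μ ((fun c => c j) ⁻¹' {x : S × ℝ | e < |x.2 - M.optValue x.1|}) ≤ ENNReal.ofReal p := by
    have h1 := (measurePreserving_eval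
      (fun j : A × Fin C => M.childKernel κ j.1 s) j).measure_preimage hms.nullMeasurableSet
    exact h1.le.trans (M.childKernel_inaccurate_le κ hκ s j.1)
  refine (measure_mono hsub).trans ((measure_union_le _ _).trans ?_)
  rw [ENNReal.ofReal_add (by positivity) (by positivity)]
  refine add_le_add ((measure_iUnion_fintype_le _ _).trans ?_)
    ((measure_iUnion_fintype_le _ _).trans ?_)
  · refine (Finset.sum_le_card_nsmul _ _ _ fun a _ => hacc κ s a).trans_eq ?_
    rw [nsmul_eq_mul, ENNReal.ofReal_mul (by positivity), ENNReal.ofReal_natCast,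
      Finset.card_univ]
  · refine (Finset.sum_le_card_nsmul _ _ _ fun j _ => hchild j).trans_eq ?_
    rw [nsmul_eq_mul, ENNReal.ofReal_mul (by positivity), ENNReal.ofReal_mul (by positivity),
      ENNReal.ofReal_natCast, ENNReal.ofReal_natCast, Finset.card_univ, Fintype.card_prod,
      Fintype.card_fin, Nat.cast_mul]

/-- The errors obey `e' = γ * (l + e)`, whose fixed point is `γ * l / (1 - γ)`; the excess over it,
`Vmax` at the leaves, shrinks by `γ` per level. The failure probabilities obey `p' = |A| * h + |A| *
C * p`. -/
lemma nodeKernel_inaccurate_le (M : MDP S A) {C : ℕ} (hC : 0 < C) {l h : ℝ}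
    (hacc : M.SampleAccurate C l h) (hl : 0 ≤ l) (hh : 0 ≤ h) (n : ℕ) (s : S) :
    (M.nodeKernel C n).1 s (M.inaccurate (M.γ ^ n * M.Vmax + M.γ * l / (1 - M.γ)) s) ≤
      ENNReal.ofReal (n * (Fintype.card A * C : ℝ) ^ n * h) := by
  have hγ := sub_pos.2 M.γ_lt_one
  induction n generalizing s with
  | zero =>
    have hzero : M.inaccurate (M.γ ^ 0 * M.Vmax + M.γ * l / (1 - M.γ)) s ⊆ {0}ᶜ := by
      rintro q ⟨a, ha⟩ rfl
      have h1 := M.optQ_mem_Icc s a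
      have h2 : 0 ≤ M.γ * l / (1 - M.γ) :=
        div_nonneg (mul_nonneg M.γ_pos.le hl) hγ.le
      rw [Pi.zero_apply, zero_sub, abs_neg, abs_of_nonneg h1.1] at ha
      linarith [h1.2]
    refine (measure_mono hzero).trans ?_
    change Measure.dirac 0 _ ≤ _
    rw [Measure.dirac_apply' _ (measurableSet_singleton _).compl]
    simp
  | succ n ih =>
    have := (M.nodeKernel C n).2
    have hA : (1 : ℝ) ≤ Fintype.card A := Nat.one_le_cast.2 Fintype.card_pos
    have hC' : (1 : ℝ) ≤ C := Nat.one_le_cast.2 hC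
    have key := M.levelKernel_inaccurate_le hC (M.nodeKernel C n).1 hacc ih hh (by positivity) s
    have he : M.γ ^ (n + 1) * M.Vmax + M.γ * l / (1 - M.γ) =
        M.γ * (l + (M.γ ^ n * M.Vmax + M.γ * l / (1 - M.γ))) := by
      field_simp
      ring
    rw [he]
    refine key.trans (ENNReal.ofReal_le_ofReal ?_)
    have h1 : (Fintype.card A : ℝ) ≤ (Fintype.card A * C : ℝ) ^ (n + 1) :=
      (le_mul_of_one_le_right (by positivity) hC').trans
        (le_self_pow₀ (one_le_mul_of_one_le_of_one_le hA hC') n.succ_ne_zero)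
    have h2 := mul_le_mul_of_nonneg_right h1 hh
    push_cast
    calc (Fintype.card A * h + Fintype.card A * C * (n * (Fintype.card A * C : ℝ) ^ n * h) : ℝ)
        = Fintype.card A * h + n * (Fintype.card A * C : ℝ) ^ (n + 1) * h := by ring
      _ ≤ _ := by linarith

end StableRL.MDP

/-! ### The prescribed depth and width suffice -/

namespace StableRL

/-- In logarithms, with `c = C / y`, the width also appears in the union bound through `H * log c`.
The tangent bound `log (c / H) ≤ c / H - 1` trades this term for `c`, leaving `3 * c` of the
exponent `4 * c` to absorb the rest. -/
lemma union_bound_mul_exp_le {y N C δ : ℝ} {H : ℕ} (hy : 1 ≤ y) (hN : 1 ≤ N) (hH : 0 < H)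
    (hC : 0 < C) (hδ : 0 < δ)
    (h : y * (2 * H * Real.log (y * N * H) + Real.log (2 / δ)) ≤ C) :
    H * (N * C) ^ H * (2 * Real.exp (-(4 * C / y))) ≤ δ := by
  have hH1 : (1 : ℝ) ≤ H := Nat.one_le_cast.2 hH
  have hy0 : 0 < y := by linarith
  have hN0 : 0 < N := by linarith
  have hH0 : (0 : ℝ) < H := by linarith
  obtain ⟨c, rfl⟩ : ∃ c, C = y * c := ⟨C / y, by field_simp⟩
  have hc : 0 < c := pos_of_mul_pos_right hC hy0.le
  have hK := le_of_mul_le_mul_left h hy0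
  rw [Real.log_mul (by positivity) (by positivity), Real.log_mul (by positivity) (by positivity),
    Real.log_div (by positivity) (by positivity)] at hK
  have h1 := mul_nonneg hH0.le (Real.log_nonneg hy)
  have h2 := mul_nonneg hH0.le (Real.log_nonneg hN)
  have h3 := mul_nonneg hH0.le (Real.log_nonneg hH1)
  have h4 : H * Real.log c ≤ H * Real.log H + c - H := by
    have h5 := Real.log_le_sub_one_of_pos (div_pos hc hH0)
    rw [Real.log_div hc.ne' hH0.ne'] at h5
    have h6 := mul_le_mul_of_nonneg_left h5 hH0.le
    have h7 : (H : ℝ) * (c / H - 1) = c - H := by field_simp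
    linarith
  have h8 := Real.log_le_sub_one_of_pos hH0
  have hlog : Real.log (N * (y * c)) = Real.log N + (Real.log y + Real.log c) := by
    rw [Real.log_mul (by positivity) (by positivity), Real.log_mul (by positivity) (by positivity)]
  have hdiv : 4 * (y * c) / y = 4 * c := by field_simp
  have hpow : (N * (y * c)) ^ H = Real.exp (H * Real.log (N * (y * c))) := by
    rw [Real.exp_nat_mul, Real.exp_log (by positivity)]
  calc H * (N * (y * c)) ^ H * (2 * Real.exp (-(4 * (y * c) / y)))
      = Real.exp (Real.log H + H * Real.log (N * (y * c)) + (Real.log 2 + -(4 * c))) := by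
        rw [Real.exp_add, Real.exp_add, Real.exp_add, Real.exp_log hH0, Real.exp_log two_pos,
          hpow, hdiv]
    _ ≤ Real.exp (Real.log δ) := by
        refine Real.exp_le_exp.2 ?_
        rw [hlog]
        linarith
    _ = δ := Real.exp_log hδ

namespace MDP

variable {S A : Type*} [MeasurableSpace S] [MeasurableSpace A]

lemma depth_pos (M : MDP S A) {δ : ℝ} (hδ : 0 < δ) (hδ1 : δ < 1) : 0 < M.depth δ :=
  Nat.ceil_pos.2 (Real.logb_pos_of_base_lt_one M.γ_pos M.γ_lt_one hδ hδ1)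

lemma pow_depth_le (M : MDP S A) {δ : ℝ} (hδ : 0 < δ) : M.γ ^ M.depth δ ≤ δ := by
  have h1 : Real.logb M.γ δ ≤ M.depth δ := Nat.le_ceil _
  rw [Real.logb, div_le_iff_of_neg (Real.log_neg M.γ_pos M.γ_lt_one), ← Real.log_pow] at h1
  exact (Real.log_le_log_iff (pow_pos M.γ_pos _) hδ).1 h1

lemma width_pos [Fintype A] (M : MDP S A) (δ : ℝ) : 0 < M.width δ :=
  lt_max_of_lt_left one_pos

variable [Fintype A] [Nonempty A] [DiscreteMeasurableSpace A]

/-- With probability `1 - δ` the estimates of the oracle are accurate up to `2 δ Rmax / (1 - γ)`. -/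
lemma oracle_inaccurate_le (M : MDP S A) {δ : ℝ} (hδ : 0 < δ) (hδ1 : δ < 1) (s : S) :
    M.oracle (M.width δ) (M.depth δ) s (M.inaccurate (2 * δ * M.Vmax) s) ≤ ENNReal.ofReal δ := by
  have hγ := sub_pos.2 M.γ_lt_one
  have hγ0 := M.γ_pos
  have hV := M.Vmax_pos
  have hR := M.Rmax_pos
  have hpow := mul_le_mul_of_nonneg_right (M.pow_depth_le hδ) hV.le
  set H := M.depth δ with hH
  set C := M.width δ with hC
  have hC0 : 0 < C := M.width_pos δ
  have hmono {e : ℝ} (he : e ≤ 2 * δ * M.Vmax) :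
      M.inaccurate (2 * δ * M.Vmax) s ⊆ M.inaccurate e s :=
    fun q ⟨a, ha⟩ => ⟨a, he.trans_lt ha⟩
  set y := 2 * M.γ ^ 2 / (δ ^ 2 * (1 - M.γ) ^ 2) with hy
  -- If `y < 1`, then `γ ≤ δ * (1 - γ)` and even the worst sampling error `Vmax` is harmless.
  -- Otherwise `log y` is nonnegative, and `l = δ * Rmax / γ` makes the accumulated sampling error
  -- exactly `δ * Vmax`; the truncation at depth `H` costs another `δ * Vmax`.
  rcases lt_or_ge y 1 with hy1 | hy1
  · have h1 : M.γ ≤ δ * (1 - M.γ) := by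
      rw [hy, div_lt_one (by positivity)] at hy1
      refine le_of_sq_le_sq ?_ (by positivity)
      nlinarith [sq_nonneg M.γ]
    have h2 : M.γ * M.Vmax / (1 - M.γ) ≤ δ * M.Vmax := by
      rw [div_le_iff₀ hγ]
      nlinarith
    refine (measure_mono (hmono ?_)).trans ((M.nodeKernel_inaccurate_le hC0
      (M.sampleAccurate_Vmax hC0) hV.le le_rfl H s).trans (ENNReal.ofReal_le_ofReal ?_))
    · linarith
    · simpa using hδ.le
  · have h1 : M.γ * (δ * M.Rmax / M.γ) / (1 - M.γ) = δ * M.Vmax := by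
      unfold Vmax
      field_simp
    have h2 : 2 * C * (δ * M.Rmax / M.γ) ^ 2 / M.Vmax ^ 2 = 4 * C / y := by
      rw [hy]
      unfold Vmax
      field_simp
      ring
    have hl : 0 ≤ δ * M.Rmax / M.γ := by positivity
    have hacc := M.sampleAccurate_hoeffding hC0 hl
    rw [h2] at hacc
    refine (measure_mono (hmono ?_)).trans ((M.nodeKernel_inaccurate_le hC0 hacc hl
      (by positivity) H s).trans (ENNReal.ofReal_le_ofReal ?_))
    · linarith
    · refine union_bound_mul_exp_le hy1 (Nat.one_le_cast.2 Fintype.card_pos)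
        (M.depth_pos hδ hδ1) (Nat.cast_pos.2 hC0) hδ ?_
      have harg : y * Fintype.card A * H =
          2 * M.γ ^ 2 * (Fintype.card A : ℝ) * H / (δ ^ 2 * (1 - M.γ) ^ 2) := by
        rw [hy]
        ring
      rw [harg]
      refine (Nat.le_ceil _).trans (Nat.cast_le.2 ?_)
      rw [hC, width]
      exact le_max_right _ _

end MDP

/-! ## The Boltzmann distribution close to a vector with a gap -/

/-- Relative to `E = exp ((m + ε) / τ)`, an optimal term lies between `E * exp (-(2 * ε / τ))` and
`E`, and a suboptimal one is at most `E * exp (-g)`. -/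
lemma boltzmannWeight_ge {A : Type*} [Fintype A] {τ ε g m : ℝ} (hτ : 0 < τ) {q Q : A → ℝ}
    {O : Finset A} (hO : ∀ a ∈ O, Q a = m) (hnO : ∀ a ∉ O, Q a + τ * g ≤ m)
    (hq : ∀ a, |q a - Q a| ≤ ε) {a : A} (ha : a ∈ O) :
    (1 - (2 * ε / τ + Fintype.card A * Real.exp (-g))) / (O.card : ℝ) ≤
      boltzmannWeight τ q a := by
  classical
  have hn : (1 : ℝ) ≤ O.card := Nat.one_le_cast.2 (Finset.card_pos.2 ⟨a, ha⟩)
  set n : ℝ := (O.card : ℝ)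
  set x : ℝ := Fintype.card A * Real.exp (-g) with hx
  have hx0 : 0 ≤ x := by positivity
  set E : ℝ := Real.exp ((m + ε) / τ) with hE
  have hE0 : 0 < E := Real.exp_pos _
  have hden : ∑ b, Real.exp (q b / τ) ≤ n * (1 + x) * E := by
    have h1 : ∀ b, Real.exp (q b / τ) ≤ (if b ∈ O then E else 0) + E * Real.exp (-g) := by
      intro b
      have hqb := (abs_le.1 (hq b)).2
      split_ifs with hb
      · refine le_add_of_le_of_nonneg (Real.exp_le_exp.2 ?_) (by positivity)
        have := hO b hb
        gcongr
        linarith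
      · rw [zero_add, hE, ← Real.exp_add]
        refine Real.exp_le_exp.2 ?_
        have h2 := hnO b hb
        rw [div_le_iff₀ hτ, add_mul, div_mul_cancel₀ _ hτ.ne']
        linarith
    calc ∑ b, Real.exp (q b / τ)
        ≤ ∑ b, ((if b ∈ O then E else 0) + E * Real.exp (-g)) := Finset.sum_le_sum fun b _ => h1 b
      _ = n * E + x * E := by
        rw [Finset.sum_add_distrib, Finset.sum_ite_mem, Finset.univ_inter, Finset.sum_const,
          Finset.sum_const, nsmul_eq_mul, nsmul_eq_mul, Finset.card_univ, hx]
        ring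
      _ ≤ n * (1 + x) * E := by
        have := mul_le_mul_of_nonneg_right hn (mul_nonneg hx0 hE0.le)
        linarith
  have hnum : E * Real.exp (-(2 * ε / τ)) ≤ Real.exp (q a / τ) := by
    rw [hE, ← Real.exp_add]
    refine Real.exp_le_exp.2 ?_
    have h2 := hO a ha
    have hqa := (abs_le.1 (hq a)).1
    rw [← sub_eq_add_neg, ← sub_div]
    gcongr
    linarith
  have hpos : 0 < ∑ b, Real.exp (q b / τ) :=
    Finset.sum_pos (fun b _ => Real.exp_pos _) ⟨a, Finset.mem_univ a⟩
  calc (1 - (2 * ε / τ + x)) / n ≤ E * Real.exp (-(2 * ε / τ)) / (n * (1 + x) * E) := by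
        rw [div_le_div_iff₀ (by positivity) (by positivity)]
        have hε : 0 ≤ 2 * ε / τ := by
          have := (abs_nonneg _).trans (hq a)
          positivity
        have h3 := Real.one_sub_le_exp_neg (2 * ε / τ)
        -- With `u = 2 * ε / τ`, the left side equals `1 - u - u * x - x ^ 2`, hence is at most `1 -
        -- u`.
        have h4 : (1 - (2 * ε / τ + x)) * (1 + x) ≤ Real.exp (-(2 * ε / τ)) := by
          nlinarith [mul_nonneg hε hx0, mul_nonneg hx0 hx0]
        calc (1 - (2 * ε / τ + x)) * (n * (1 + x) * E)
            = (1 - (2 * ε / τ + x)) * (1 + x) * (n * E) := by ring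
          _ ≤ Real.exp (-(2 * ε / τ)) * (n * E) := by gcongr
          _ = _ := by ring
    _ ≤ _ := div_le_div₀ (Real.exp_pos _).le hnum hpos hden

namespace MDP

variable {S A : Type*} [MeasurableSpace S] [MeasurableSpace A] [Fintype A]

lemma mem_optActions (M : MDP S A) {s : S} {a : A} :
    a ∈ M.optActions s ↔ ∀ b, M.optQ s b ≤ M.optQ s a := by
  classical
  simp [optActions]

lemma optPolicy_nonneg (M : MDP S A) (s : S) (a : A) : 0 ≤ M.optPolicy s a := by
  unfold optPolicy
  split_ifs <;> positivity

variable [Nonempty A]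

lemma nonempty_optActions (M : MDP S A) (s : S) : (M.optActions s).Nonempty := by
  obtain ⟨a, ha⟩ := exists_eq_maxQ (M.optQ s)
  exact ⟨a, M.mem_optActions.2 fun b => ha ▸ le_maxQ _ b⟩

lemma optQ_eq_maxQ (M : MDP S A) {s : S} {a : A} (ha : a ∈ M.optActions s) :
    M.optQ s a = maxQ (M.optQ s) :=
  le_antisymm (le_maxQ _ a) (maxQ_le (M.mem_optActions.1 ha))

lemma sum_optPolicy (M : MDP S A) (s : S) : ∑ a, M.optPolicy s a = 1 := by
  classical
  have h : ((M.optActions s).card : ℝ) ≠ 0 :=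
    Nat.cast_ne_zero.2 (Finset.card_pos.2 (M.nonempty_optActions s)).ne'
  unfold optPolicy
  rw [Finset.sum_ite_mem, Finset.univ_inter, Finset.sum_const, nsmul_eq_mul, mul_one_div_cancel h]

lemma optQ_add_le_maxQ (M : MDP S A) {τ g : ℝ} (hg : 0 < g) (hτ : (τ : EReal) ≤ M.gap / g)
    {s : S} {a : A} (ha : a ∉ M.optActions s) : M.optQ s a + τ * g ≤ maxQ (M.optQ s) := by
  have h1 : M.gap ≤ ((maxQ (M.optQ s) - M.optQ s a : ℝ) : EReal) := by
    refine (iInf_le _ s).trans ?_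
    rw [gapAt, EReal.coe_sub]
    refine EReal.sub_le_sub (iSup_le fun b => EReal.coe_le_coe_iff.2 (le_maxQ _ b)) ?_
    exact le_iSup (fun b : {b : A // b ∉ M.optActions s} => (M.optQ s b.1 : EReal)) ⟨a, ha⟩
  have h2 := hτ.trans (EReal.div_le_div_right_of_nonneg (EReal.coe_nonneg.2 hg.le) h1)
  rw [← EReal.coe_div, EReal.coe_le_coe_iff, le_div_iff₀ hg] at h2
  linarith

variable [DiscreteMeasurableSpace A]

/-- The oracle policy chooses each action almost as often as the optimal policy. -/
lemma oraclePolicy_ge (M : MDP S A) {τ g : ℝ} (hτ : 0 < τ) (hτ1 : τ ^ 2 < 1) (hg : 0 < g)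
    (hgap : (τ : EReal) ≤ M.gap / g) {η : ℝ}
    (hη : 4 * τ * M.Vmax + Fintype.card A * Real.exp (-g) ≤ η) (s : S) (a : A) :
    ENNReal.ofReal ((1 - τ ^ 2) * (1 - η) * M.optPolicy s a) ≤
      (M.oraclePolicy (M.width (τ ^ 2)) (M.depth (τ ^ 2)) τ).1 s {a} := by
  have hδ : 0 < τ ^ 2 := by positivity
  set κ := M.oracle (M.width (τ ^ 2)) (M.depth (τ ^ 2)) with hκ
  have hbad := M.oracle_inaccurate_le hδ hτ1 s
  have hmeas := M.measurableSet_inaccurate (2 * τ ^ 2 * M.Vmax) s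
  set b := M.inaccurate (2 * τ ^ 2 * M.Vmax) s with hb
  have hw (q : A → ℝ) (hq : q ∈ bᶜ) :
      ENNReal.ofReal ((1 - η) * M.optPolicy s a) ≤ boltzmannKernel A τ q {a} := by
    have hk : boltzmannKernel A τ q {a} = ENNReal.ofReal (boltzmannWeight τ q a) := by
      change (∑ b, ENNReal.ofReal (boltzmannWeight τ q b) • Measure.dirac b) {a} = _
      classical
      simp only [Measure.coe_finsetSum, Finset.sum_apply, Measure.smul_apply, smul_eq_mul]
      rw [Finset.sum_eq_single a (fun c _ hc => by simp [hc])
        (fun h => absurd (Finset.mem_univ a) h)]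
      simp
    rw [hk]
    refine ENNReal.ofReal_le_ofReal ?_
    unfold optPolicy
    split_ifs with ha
    · have hq' : ∀ c, |q c - M.optQ s c| ≤ 2 * τ ^ 2 * M.Vmax := by
        intro c
        by_contra hc
        exact hq ⟨c, not_le.1 hc⟩
      refine le_trans ?_ (boltzmannWeight_ge hτ (fun c hc => M.optQ_eq_maxQ hc)
        (fun c hc => M.optQ_add_le_maxQ hg hgap hc) hq' ha)
      -- This is why `δ = τ ^ 2`: after division by the temperature the error is still of order `τ`.
      have h1 : 2 * (2 * τ ^ 2 * M.Vmax) / τ = 4 * τ * M.Vmax := by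
        field_simp
        ring
      rw [mul_one_div, h1]
      gcongr
    · rw [mul_zero]
      unfold boltzmannWeight
      positivity
  have hgood : ENNReal.ofReal (1 - τ ^ 2) ≤ κ s bᶜ := by
    rw [prob_compl_eq_one_sub hmeas, ENNReal.ofReal_sub _ hδ.le, ENNReal.ofReal_one]
    exact tsub_le_tsub_left hbad 1
  change _ ≤ (boltzmannKernel A τ ∘ₖ κ) s {a}
  rw [Kernel.comp_apply' _ _ _ (measurableSet_singleton a), mul_assoc,
    ENNReal.ofReal_mul (sub_nonneg.2 hτ1.le)]
  calc ENNReal.ofReal (1 - τ ^ 2) * ENNReal.ofReal ((1 - η) * M.optPolicy s a)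
      ≤ κ s bᶜ * ENNReal.ofReal ((1 - η) * M.optPolicy s a) := by gcongr
    _ = ∫⁻ q in bᶜ, ENNReal.ofReal ((1 - η) * M.optPolicy s a) ∂(κ s) := by
        rw [setLIntegral_const, mul_comm]
    _ ≤ ∫⁻ q in bᶜ, boltzmannKernel A τ q {a} ∂(κ s) :=
        setLIntegral_mono' hmeas.compl hw
    _ ≤ _ := setLIntegral_le_lintegral _ _

end StableRL.MDP

/-! ### Hitting times and survival indicators -/

namespace StableRL.MDP

variable {S A : Type*}

/-- The indicator of the event that `D` is not visited up to time `k`. -/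
def notHit (D : Set S) (k : ℕ) (ω : ℕ → S × A) : ℝ≥0∞ :=
  ∏ j ∈ Finset.range (k + 1), Dᶜ.indicator 1 (ω j).1

lemma notHit_succ (D : Set S) (k : ℕ) (ω : ℕ → S × A) :
    notHit D (k + 1) ω = notHit D k ω * Dᶜ.indicator 1 (ω (k + 1)).1 :=
  Finset.prod_range_succ _ _

lemma notHit_le_one (D : Set S) (k : ℕ) (ω : ℕ → S × A) : notHit D k ω ≤ 1 :=
  Finset.prod_le_one' fun _ _ => Set.indicator_le_self' (fun _ _ => zero_le) _

/-- The tail-sum formula: `notHit D k` indicates that the hitting time exceeds `k`. -/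
lemma hitTime_le_tsum (D : Set S) (ω : ℕ → S × A) : hitTime D ω ≤ ∑' k, notHit D k ω := by
  classical
  by_cases h : ∃ n, (ω n).1 ∈ D
  · have h1 (k : ℕ) (hk : k ∈ Finset.range (Nat.find h)) : notHit D k ω = 1 := by
      refine Finset.prod_eq_one fun j hj => ?_
      have hjn : j < Nat.find h :=
        (Finset.mem_range_succ_iff.1 hj).trans_lt (Finset.mem_range.1 hk)
      rw [Set.indicator_of_mem (Nat.find_min h hjn), Pi.one_apply]
    calc hitTime D ω ≤ (Nat.find h : ℝ≥0∞) := 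
        iInf₂_le (f := fun k (_ : (ω k).1 ∈ D) => (k : ℝ≥0∞)) _ (Nat.find_spec h)
      _ = ∑ k ∈ Finset.range (Nat.find h), notHit D k ω := by
        rw [Finset.sum_congr rfl h1]
        simp
      _ ≤ _ := ENNReal.sum_le_tsum _
  · push Not at h
    have h1 (k : ℕ) : notHit D k ω = 1 :=
      Finset.prod_eq_one fun j _ => by rw [Set.indicator_of_mem (h j), Pi.one_apply]
    simp [h1]

variable [MeasurableSpace S] [MeasurableSpace A]

/-! ## Geometric drift -/

lemma lintegral_pathLaw_state_succ_le (M : MDP S A) (π : Policy S A) (s : S) {f : S → ℝ≥0∞}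
    (hf : Measurable f) {r b : ℝ≥0∞}
    (hdrift : ∀ s, ∫⁻ a, ∫⁻ s', f s' ∂(M.trans (s, a)) ∂(π.1 s) ≤ r * f s + b) (t : ℕ) :
    ∫⁻ ω, ∫⁻ s', f s' ∂(M.trans (ω t)) ∂(M.pathLaw (fun _ => π) s) ≤
      r * ∫⁻ ω, f (ω t).1 ∂(M.pathLaw (fun _ => π) s) + b := by
  have hft : Measurable fun ω : ℕ → S × A => f (ω t).1 :=
    hf.comp (measurable_fst.comp (measurable_pi_apply t))
  rw [M.lintegral_pathLaw_eq_lintegral_policy (fun _ => π) s t (M.measurable_lintegral_trans hf)]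
  refine (lintegral_mono fun ω : ℕ → S × A => hdrift (ω t).1).trans_eq ?_
  rw [lintegral_add_right _ measurable_const, lintegral_const_mul _ hft]
  simp

/-- The condition `r * c + b ≤ c` lets `c` absorb the additive term at every step, so that the terms
`b` do not accumulate. -/
lemma lintegral_pathLaw_state_le (M : MDP S A) (π : Policy S A) (s : S) {f : S → ℝ≥0∞}
    (hf : Measurable f) {r b c : ℝ≥0∞}
    (hdrift : ∀ s, ∫⁻ a, ∫⁻ s', f s' ∂(M.trans (s, a)) ∂(π.1 s) ≤ r * f s + b)
    (hc : r * c + b ≤ c) (t : ℕ) :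
    ∫⁻ ω, f (ω t).1 ∂(M.pathLaw (fun _ => π) s) ≤ r ^ t * f s + c := by
  induction t with
  | zero =>
    rw [M.lintegral_pathLaw_zero (fun _ => π) s (F := fun x => f x.1) (hf.comp measurable_fst)]
    simp
  | succ t ih =>
    rw [M.lintegral_pathLaw_state_succ (fun _ => π) s t hf]
    calc _ ≤ r * ∫⁻ ω, f (ω t).1 ∂(M.pathLaw (fun _ => π) s) + b :=
          M.lintegral_pathLaw_state_succ_le π s hf hdrift t
      _ ≤ r * (r ^ t * f s + c) + b := by gcongr
      _ = r ^ (t + 1) * f s + (r * c + b) := by ring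
      _ ≤ _ := by gcongr

/-- Markov's inequality; the factor 2 appears because the transient `r ^ t * f s` eventually falls
below `c`. -/
lemma limsup_pathLaw_notMem_le (M : MDP S A) (π : Policy S A) (s : S) {f : S → ℝ≥0∞}
    (hf : Measurable f) (hfs : f s ≠ ∞) {r b c : ℝ≥0∞} (hr : r < 1)
    (hdrift : ∀ s, ∫⁻ a, ∫⁻ s', f s' ∂(M.trans (s, a)) ∂(π.1 s) ≤ r * f s + b)
    (hc : r * c + b ≤ c) (hc0 : 0 < c) {D : Set S} {K : ℝ≥0∞} (hK0 : K ≠ 0) (hK : K ≠ ∞)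
    (hD : ∀ s ∉ D, K ≤ f s) {θ : ℝ≥0∞} (hθ : 2 * c / K ≤ θ) :
    limsup (fun t : ℕ => M.pathLaw (fun _ => π) s {ω | (ω t).1 ∉ D}) atTop ≤ θ := by
  have hlim : Tendsto (fun t : ℕ => r ^ t * f s) atTop (nhds 0) := by
    simpa using ENNReal.Tendsto.mul_const
      (ENNReal.tendsto_pow_atTop_nhds_zero_of_lt_one hr) (Or.inr hfs)
  refine limsup_le_of_le (by isBoundedDefault) ?_
  filter_upwards [hlim.eventually_lt_const hc0] with t ht
  have hft : Measurable fun ω : ℕ → S × A => f (ω t).1 :=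
    hf.comp (measurable_fst.comp (measurable_pi_apply t))
  calc M.pathLaw (fun _ => π) s {ω | (ω t).1 ∉ D}
      ≤ M.pathLaw (fun _ => π) s {ω | K ≤ f (ω t).1} := measure_mono fun ω hω => hD _ hω
    _ ≤ (∫⁻ ω, f (ω t).1 ∂(M.pathLaw (fun _ => π) s)) / K :=
        meas_ge_le_lintegral_div hft.aemeasurable hK0 hK
    _ ≤ 2 * c / K := by
        gcongr
        refine (M.lintegral_pathLaw_state_le π s hf hdrift hc t).trans ?_
        rw [two_mul]
        gcongr
    _ ≤ θ := hθ

lemma measurable_indicator_one_compl {D : Set S} (hD : MeasurableSet D) :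
    Measurable (Dᶜ.indicator (1 : S → ℝ≥0∞)) :=
  measurable_one.indicator hD.compl

lemma measurable_notHit {D : Set S} (hD : MeasurableSet D) (k : ℕ) :
    Measurable (notHit (A := A) D k) :=
  Finset.measurable_prod _ fun j _ => (measurable_indicator_one_compl hD).comp
    (measurable_fst.comp (measurable_pi_apply j))

lemma lintegral_notHit_mul_succ (M : MDP S A) (π : ℕ → Policy S A) (s : S) {D : Set S}
    (hD : MeasurableSet D) (k : ℕ) {F : S × A → ℝ≥0∞} (hF : Measurable F) :
    ∫⁻ ω, notHit D k ω * F (ω (k + 1)) ∂(M.pathLaw π s) =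
      ∫⁻ ω, notHit D k ω * (∫⁻ s', ∫⁻ a', F (s', a') ∂((π (k + 1)).1 s') ∂(M.trans (ω k)))
        ∂(M.pathLaw π s) := by
  have hG : Measurable fun h : Π _ : Finset.Iic k, S × A =>
      ∏ j : Finset.Iic k, Dᶜ.indicator (1 : S → ℝ≥0∞) (h j).1 :=
    Finset.measurable_prod _ fun j _ => (measurable_indicator_one_compl hD).comp
      (measurable_fst.comp (measurable_pi_apply j))
  have hGeq (ω : ℕ → S × A) : notHit D k ω =
      ∏ j : Finset.Iic k, Dᶜ.indicator (1 : S → ℝ≥0∞)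
        (Preorder.frestrictLe (π := fun _ => S × A) k ω j).1 := by
    rw [notHit, Nat.range_succ_eq_Iic]
    exact (Finset.prod_coe_sort (Finset.Iic k)
      fun j => Dᶜ.indicator (1 : S → ℝ≥0∞) (ω j).1).symm
  simp_rw [hGeq]
  exact M.lintegral_pathLaw_mul_succ π s k hG hF

/-- Let `u k` be the mean of `f` at time `k + 1` on the event of no visit up to time `k`. Surviving
one more step puts the state outside `D`, where the drift has no additive term, so `u (k + 1) ≤ r *
u k`. As `1 ≤ f`, `u k` bounds the probability of no visit up to time `k + 1`. The term `b` enters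
only through the first step. -/
lemma lintegral_hitTime_lt_top (M : MDP S A) (π : Policy S A) (s : S) {f : S → ℝ≥0∞}
    (hf : Measurable f) (hfs : f s ≠ ∞) (hf1 : ∀ s, 1 ≤ f s) {r b : ℝ≥0∞} (hr : r < 1)
    (hb : b ≠ ∞)
    (hdrift : ∀ s, ∫⁻ a, ∫⁻ s', f s' ∂(M.trans (s, a)) ∂(π.1 s) ≤ r * f s + b)
    {D : Set S} (hD : MeasurableSet D)
    (hdriftD : ∀ s ∉ D, ∫⁻ a, ∫⁻ s', f s' ∂(M.trans (s, a)) ∂(π.1 s) ≤ r * f s) :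
    ∫⁻ ω, hitTime D ω ∂(M.pathLaw (fun _ => π) s) < ∞ := by
  set P := M.pathLaw (fun _ => π) s with hP
  set u : ℕ → ℝ≥0∞ := fun k => ∫⁻ ω, notHit D k ω * ∫⁻ s', f s' ∂(M.trans (ω k)) ∂P with hu
  have hh : Measurable fun x : S × A => ∫⁻ s', f s' ∂(M.trans x) := M.measurable_lintegral_trans hf
  have hu0 : u 0 ≤ r * f s + b := by
    calc u 0 ≤ ∫⁻ ω, ∫⁻ s', f s' ∂(M.trans (ω 0)) ∂P := by
          refine lintegral_mono fun ω => ?_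
          exact mul_le_of_le_one_left' (notHit_le_one D 0 ω)
      _ = ∫⁻ a, ∫⁻ s', f s' ∂(M.trans (s, a)) ∂(π.1 s) :=
          M.lintegral_pathLaw_zero (fun _ => π) s hh
      _ ≤ _ := hdrift s
  have hsucc (k : ℕ) : u (k + 1) ≤ r * u k := by
    have hF : Measurable fun x : S × A =>
        Dᶜ.indicator (1 : S → ℝ≥0∞) x.1 * ∫⁻ s', f s' ∂(M.trans x) :=
      ((measurable_indicator_one_compl hD).comp measurable_fst).mul hh
    simp only [hu, notHit_succ, mul_assoc]
    have hm : Measurable fun ω : ℕ → S × A => notHit D k ω * ∫⁻ s', f s' ∂(M.trans (ω k)) :=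
      (measurable_notHit hD k).mul (hh.comp (measurable_pi_apply k))
    rw [M.lintegral_notHit_mul_succ (fun _ => π) s hD k hF, ← lintegral_const_mul _ hm]
    refine lintegral_mono fun ω => ?_
    change _ ≤ r * (notHit D k ω * ∫⁻ s', f s' ∂(M.trans (ω k)))
    rw [mul_left_comm, ← lintegral_const_mul _ hf]
    gcongr with s'
    by_cases hs' : s' ∈ D
    · simp [hs']
    · simpa [hs'] using hdriftD s' hs'
  have hpow (k : ℕ) : u k ≤ r ^ k * u 0 := by
    induction k with
    | zero => simp
    | succ k ih => calc u (k + 1) ≤ r * u k := hsucc k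
        _ ≤ r * (r ^ k * u 0) := by gcongr
        _ = r ^ (k + 1) * u 0 := by ring
  have hP1 (k : ℕ) : ∫⁻ ω, notHit D (k + 1) ω ∂P ≤ u k := by
    have h1 := M.lintegral_notHit_mul_succ (fun _ => π) s hD k (F := fun x => f x.1)
      (hf.comp measurable_fst)
    simp only [lintegral_const, measure_univ, mul_one] at h1
    refine le_of_le_of_eq ?_ h1
    refine lintegral_mono fun ω => ?_
    rw [notHit_succ]
    gcongr
    exact (Set.indicator_le_self' (fun _ _ => zero_le) _).trans (hf1 _)
  have hP0 : ∫⁻ ω, notHit D 0 ω ∂P ≤ 1 :=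
    (lintegral_mono fun ω => notHit_le_one D 0 ω).trans (by simp)
  calc ∫⁻ ω, hitTime D ω ∂P ≤ ∫⁻ ω, ∑' k, notHit D k ω ∂P :=
        lintegral_mono fun ω => hitTime_le_tsum D ω
    _ = ∑' k, ∫⁻ ω, notHit D k ω ∂P :=
        lintegral_tsum fun k => (measurable_notHit hD k).aemeasurable
    _ = ∫⁻ ω, notHit D 0 ω ∂P + ∑' k, ∫⁻ ω, notHit D (k + 1) ω ∂P :=
        tsum_eq_zero_add' ENNReal.summable
    _ ≤ 1 + ∑' k, r ^ k * (r * f s + b) := by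
        gcongr with k
        exact (hP1 k).trans ((hpow k).trans (by gcongr))
    _ < ∞ := by
        rw [ENNReal.tsum_mul_right, ENNReal.tsum_geometric]
        refine ENNReal.add_lt_top.2 ⟨ENNReal.one_lt_top, ENNReal.mul_lt_top ?_ ?_⟩
        · exact (ENNReal.inv_ne_top.2 (tsub_pos_of_lt hr).ne').lt_top
        · exact ENNReal.add_lt_top.2 ⟨ENNReal.mul_lt_top (hr.trans ENNReal.one_lt_top) hfs.lt_top,
            hb.lt_top⟩

end StableRL.MDP

namespace StableRL.MDP

/-! ## Stability from drift -/

section Drift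

variable {S A : Type*} [MeasurableSpace S] [MeasurableSpace A]

lemma stable_of_exp_drift [Bornology S] (M : MDP S A) (π : Policy S A) {L : S → ℝ}
    (hLm : Measurable L) (hL0 : ∀ s, 0 ≤ L s) (hLb : ∀ ℓ, Bornology.IsBounded {s | L s ≤ ℓ})
    {η r b B : ℝ} (hη : 0 < η) (hr0 : 0 ≤ r) (hr1 : r < 1) (hb : 0 < b)
    (hout : ∀ s, B < L s → ∫⁻ a, ∫⁻ s', ENNReal.ofReal (Real.exp (η * L s')) ∂(M.trans (s, a))
      ∂(π.1 s) ≤ ENNReal.ofReal r * ENNReal.ofReal (Real.exp (η * L s)))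
    (hin : ∀ s, L s ≤ B → ∫⁻ a, ∫⁻ s', ENNReal.ofReal (Real.exp (η * L s')) ∂(M.trans (s, a))
      ∂(π.1 s) ≤ ENNReal.ofReal b) :
    M.Stable fun _ => π := by
  intro θ hθ _
  have h1r := sub_pos.2 hr1
  set f : S → ℝ≥0∞ := fun s => ENNReal.ofReal (Real.exp (η * L s)) with hf
  have hfm : Measurable f := by fun_prop
  have hf1 (s : S) : 1 ≤ f s :=
    ENNReal.one_le_ofReal.2 (Real.one_le_exp (mul_nonneg hη.le (hL0 s)))
  have hrE : ENNReal.ofReal r < 1 := ENNReal.ofReal_lt_one.2 hr1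
  have hdrift (s : S) : ∫⁻ a, ∫⁻ s', f s' ∂(M.trans (s, a)) ∂(π.1 s) ≤
      ENNReal.ofReal r * f s + ENNReal.ofReal b := by
    rcases lt_or_ge B (L s) with h | h
    · exact (hout s h).trans le_self_add
    · exact (hin s h).trans le_add_self
  set c : ℝ := b / (1 - r) with hc
  have hc0 : 0 < c := div_pos hb h1r
  set K : ℝ := 2 * c / θ with hK
  have hK0 : 0 < K := by positivity
  -- The level is at least `B`, so the contraction holds off the set, and high enough that `exp (η *
  -- L)` exceeds `K = 2 * c / θ` there.
  set ℓ : ℝ := max B (Real.log K / η) with hℓ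
  have hD : MeasurableSet {s | L s ≤ ℓ} := measurableSet_le hLm measurable_const
  refine ⟨{s | L s ≤ ℓ}, hLb ℓ, hD, fun s => ?_, fun s => ?_⟩
  · refine M.limsup_pathLaw_notMem_le π s hfm ENNReal.ofReal_ne_top hrE hdrift
      (c := ENNReal.ofReal c) (K := ENNReal.ofReal K) ?_ (ENNReal.ofReal_pos.2 hc0)
      (ENNReal.ofReal_pos.2 hK0).ne' ENNReal.ofReal_ne_top ?_ ?_
    · rw [← ENNReal.ofReal_mul hr0, ← ENNReal.ofReal_add (by positivity) hb.le]
      refine ENNReal.ofReal_le_ofReal (le_of_eq ?_)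
      rw [hc]
      field_simp
      ring
    · intro s' hs'
      have h1 : Real.log K / η < L s' := (le_max_right B _).trans_lt (not_le.1 hs')
      rw [div_lt_iff₀' hη] at h1
      refine ENNReal.ofReal_le_ofReal ?_
      rw [← Real.exp_log hK0]
      exact Real.exp_le_exp.2 h1.le
    · rw [← ENNReal.ofReal_ofNat, ← ENNReal.ofReal_mul zero_le_two,
        ← ENNReal.ofReal_div_of_pos hK0]
      refine ENNReal.ofReal_le_ofReal (le_of_eq ?_)
      rw [hK]
      field_simp
  -- The policy is stationary, so the supremum over `t` is that of a constant.
  · refine lt_of_le_of_lt (iSup_le fun t => le_rfl) (M.lintegral_hitTime_lt_top π s hfm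
      ENNReal.ofReal_ne_top hf1 hrE ENNReal.ofReal_ne_top hdrift hD fun s' hs' => ?_)
    exact hout s' ((le_max_left B _).trans_lt (not_le.1 hs'))

end Drift

end MDP

/-! ### From the Lyapunov condition to exponential drift -/

namespace MDP.IsLyapunov

variable {d : ℕ} {S : Set (EuclideanSpace ℝ (Fin d))} {A : Type*} [Fintype A]
  [MeasurableSpace A] {M : MDP S A} {L : S → ℝ} {ν ν' B α : ℝ}

lemma isBounded_sublevel (hL : M.IsLyapunov L ν ν' B α) (ℓ : ℝ) :
    Bornology.IsBounded {s | L s ≤ ℓ} := by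
  obtain ⟨c, hc⟩ := hL.sublevel ℓ
  rw [← Bornology.isBounded_image_subtype_val, isBounded_iff_forall_norm_le]
  refine ⟨c, ?_⟩
  rintro _ ⟨s, hs, rfl⟩
  exact hc ⟨s, hs, rfl⟩

lemma exists_lt (hS : ¬ Bornology.IsBounded S) (hL : M.IsLyapunov L ν ν' B α) :
    ∃ s, B < L s := by
  obtain ⟨t, ht, hsub⟩ := hL.tendsto.eventually_gt_atTop B
  obtain ⟨c, hc⟩ := mem_atTop_sets.1 ht
  rw [isBounded_iff_forall_norm_le] at hS
  push Not at hS
  obtain ⟨s, hs, hcs⟩ := hS c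
  exact ⟨⟨s, hs⟩, hsub (hc _ hcs.le)⟩

/-- The mean increment of `L` under the action `a` in the state `s`. -/
def meanIncrement (M : MDP S A) (L : S → ℝ) (s : S) (a : A) : ℝ :=
  ∫ s', (L s' - L s) ∂(M.trans (s, a))

lemma integrable_increment (hL : M.IsLyapunov L ν ν' B α) (s : S) (a : A) :
    Integrable (fun s' => L s' - L s) (M.trans (s, a)) :=
  Integrable.of_mem_Icc (-ν) ν (hL.measurable.sub_const _).aemeasurable
    ((hL.increment s a).mono fun _ h => abs_le.1 h.1)

lemma abs_meanIncrement_le (hL : M.IsLyapunov L ν ν' B α) (s : S) (a : A) :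
    |meanIncrement M L s a| ≤ ν := by
  have := norm_integral_le_of_norm_le_const (μ := M.trans (s, a)) (f := fun s' => L s' - L s)
    (C := ν) ((hL.increment s a).mono fun _ h => h.1)
  simpa [meanIncrement] using this

lemma sum_optPolicy_mul_meanIncrement_le (hL : M.IsLyapunov L ν ν' B α) {s : S} (hs : B < L s) :
    ∑ a, M.optPolicy s a * meanIncrement M L s a ≤ -α := by
  have h := hL.drift s hs
  rw [optNext, integral_finsetSum_measure fun a _ =>
    (hL.integrable_increment s a).smul_measure ENNReal.ofReal_ne_top] at h
  refine le_of_eq_of_le (Finset.sum_congr rfl fun a _ => ?_) h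
  rw [integral_smul_measure, ENNReal.toReal_ofReal (M.optPolicy_nonneg s a), smul_eq_mul,
    meanIncrement]

/-- The mean decrease cannot exceed the largest jump. Unboundedness of the state space supplies a
state where the drift condition is active. -/
lemma drift_le_increment [Nonempty A] (hS : ¬ Bornology.IsBounded S) (hL : M.IsLyapunov L ν ν' B α) :
    α ≤ ν := by
  obtain ⟨s, hs⟩ := hL.exists_lt hS
  have h1 := hL.sum_optPolicy_mul_meanIncrement_le hs
  have h2 : ∑ a, M.optPolicy s a * -ν ≤ ∑ a, M.optPolicy s a * meanIncrement M L s a :=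
    Finset.sum_le_sum fun a _ => mul_le_mul_of_nonneg_left
      (abs_le.1 (hL.abs_meanIncrement_le s a)).1 (M.optPolicy_nonneg s a)
  rw [← Finset.sum_mul, sum_optPolicy] at h2
  linarith

/-- The bound `exp z ≤ 1 + z + z ^ 2` for `|z| ≤ 1`, applied to `z = η * (L s' - L s)`. -/
lemma lintegral_exp_le (hL : M.IsLyapunov L ν ν' B α) {η : ℝ} (hη : 0 ≤ η) (hην : η * ν ≤ 1)
    (s : S) (a : A) :
    ∫⁻ s', ENNReal.ofReal (Real.exp (η * L s')) ∂(M.trans (s, a)) ≤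
      ENNReal.ofReal
        (Real.exp (η * L s) * (1 + η * meanIncrement M L s a + (η * ν) ^ 2)) := by
  have hpt : ∀ᵐ s' ∂(M.trans (s, a)), Real.exp (η * L s') ≤
      Real.exp (η * L s) * (1 + η * (L s' - L s) + (η * ν) ^ 2) ∧
      0 ≤ Real.exp (η * L s) * (1 + η * (L s' - L s) + (η * ν) ^ 2) := by
    filter_upwards [hL.increment s a] with s' hs'
    have h1 : |η * (L s' - L s)| ≤ η * ν := by
      rw [abs_mul, abs_of_nonneg hη]
      exact mul_le_mul_of_nonneg_left hs'.1 hη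
    have h2 := (abs_le.1 (Real.abs_exp_sub_one_sub_id_le (h1.trans hην))).2
    have h3 := sq_le_sq' (abs_le.1 h1).1 (abs_le.1 h1).2
    have h4 : Real.exp (η * L s') = Real.exp (η * L s) * Real.exp (η * (L s' - L s)) := by
      rw [← Real.exp_add]
      ring_nf
    have h5 : Real.exp (η * L s') ≤
        Real.exp (η * L s) * (1 + η * (L s' - L s) + (η * ν) ^ 2) := by
      rw [h4]
      exact mul_le_mul_of_nonneg_left (by linarith) (Real.exp_pos _).le
    exact ⟨h5, (Real.exp_pos _).le.trans h5⟩
  have hint1 : Integrable (fun s' => 1 + η * (L s' - L s)) (M.trans (s, a)) :=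
    (integrable_const _).add ((hL.integrable_increment s a).const_mul η)
  have hint : Integrable (fun s' => 1 + η * (L s' - L s) + (η * ν) ^ 2) (M.trans (s, a)) :=
    hint1.add (integrable_const _)
  refine (lintegral_mono_ae (hpt.mono fun s' h => ENNReal.ofReal_le_ofReal h.1)).trans_eq ?_
  rw [← ofReal_integral_eq_lintegral_ofReal (hint.const_mul _) (hpt.mono fun s' h => h.2),
    integral_const_mul, integral_add hint1 (integrable_const _),
    integral_add (integrable_const _) ((hL.integrable_increment s a).const_mul η),
    integral_const_mul, meanIncrement]
  simp

variable [DiscreteMeasurableSpace A]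

lemma sum_policy_real (π : Policy S A) (s : S) : ∑ a, (π.1 s).real {a} = 1 := by
  rw [sum_measureReal_singleton]
  simp

lemma sum_policy_mul_meanIncrement_le_increment (hL : M.IsLyapunov L ν ν' B α) (π : Policy S A)
    (s : S) : ∑ a, (π.1 s).real {a} * meanIncrement M L s a ≤ ν := by
  have h : ∑ a, (π.1 s).real {a} * meanIncrement M L s a ≤ ∑ a, (π.1 s).real {a} * ν :=
    Finset.sum_le_sum fun a _ => mul_le_mul_of_nonneg_left
      (abs_le.1 (hL.abs_meanIncrement_le s a)).2 measureReal_nonneg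
  rwa [← Finset.sum_mul, sum_policy_real, one_mul] at h

lemma lintegral_policy_exp_le (hL : M.IsLyapunov L ν ν' B α) {η : ℝ} (hη : 0 ≤ η)
    (hην : η * ν ≤ 1) (π : Policy S A) (s : S) :
    ∫⁻ a, ∫⁻ s', ENNReal.ofReal (Real.exp (η * L s')) ∂(M.trans (s, a)) ∂(π.1 s) ≤
      ENNReal.ofReal (Real.exp (η * L s) *
        (1 + η * ∑ a, (π.1 s).real {a} * meanIncrement M L s a + (η * ν) ^ 2)) := by
  have hnn (a : A) : 0 ≤ Real.exp (η * L s) * (1 + η * meanIncrement M L s a + (η * ν) ^ 2) := by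
    have h1 := mul_le_mul_of_nonneg_left (abs_le.1 (hL.abs_meanIncrement_le s a)).1 hη
    have h2 : 0 ≤ 1 + η * meanIncrement M L s a + (η * ν) ^ 2 := by nlinarith
    positivity
  have hsum := sum_policy_real π s
  rw [lintegral_fintype]
  calc ∑ a, (∫⁻ s', ENNReal.ofReal (Real.exp (η * L s')) ∂(M.trans (s, a))) * (π.1 s) {a}
      ≤ ∑ a, ENNReal.ofReal (Real.exp (η * L s) *
          (1 + η * meanIncrement M L s a + (η * ν) ^ 2)) * ENNReal.ofReal ((π.1 s).real {a}) := by
        refine Finset.sum_le_sum fun a _ => ?_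
        rw [measureReal_def, ENNReal.ofReal_toReal (measure_ne_top _ _)]
        gcongr
        exact hL.lintegral_exp_le hη hην s a
    _ = ENNReal.ofReal (∑ a, Real.exp (η * L s) *
          (1 + η * meanIncrement M L s a + (η * ν) ^ 2) * (π.1 s).real {a}) := by
        rw [ENNReal.ofReal_sum_of_nonneg fun a _ => mul_nonneg (hnn a) measureReal_nonneg]
        exact Finset.sum_congr rfl fun a _ => (ENNReal.ofReal_mul (hnn a)).symm
    _ = _ := by
        congr 1
        calc ∑ a, Real.exp (η * L s) *
              (1 + η * meanIncrement M L s a + (η * ν) ^ 2) * (π.1 s).real {a}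
            = Real.exp (η * L s) * ((1 + (η * ν) ^ 2) * ∑ a, (π.1 s).real {a} +
                η * ∑ a, (π.1 s).real {a} * meanIncrement M L s a) := by
              simp only [Finset.mul_sum, ← Finset.sum_add_distrib]
              exact Finset.sum_congr rfl fun a _ => by ring
          _ = _ := by
              rw [hsum]
              ring

variable [Nonempty A]

/-- A policy that chooses each action almost as often as the optimal policy has half its drift. -/
lemma sum_policy_mul_meanIncrement_le (hS : ¬ Bornology.IsBounded S)
    (hL : M.IsLyapunov L ν ν' B α) (π : Policy S A)
    {s : S} (hπ : ∀ a, (1 - α / (6 * ν)) * M.optPolicy s a ≤ (π.1 s).real {a}) (hs : B < L s) :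
    ∑ a, (π.1 s).real {a} * meanIncrement M L s a ≤ -(α / 2) := by
  have hν := hL.ν_pos
  have hα := hL.α_pos
  have hαν := hL.drift_le_increment hS
  set κ := α / (6 * ν) with hκ
  have hκν : κ * ν = α / 6 := by
    rw [hκ]
    field_simp
  have hκ0 : 0 ≤ κ := by positivity
  have hκ1 : κ ≤ 1 := by
    rw [hκ, div_le_one (by positivity)]
    linarith
  have hsum := sum_policy_real π s
  -- The policy dominates `(1 - κ)` times the optimal one. The remaining mass `κ` raises the drift
  -- by at most `κ * ν = α / 6`, and since `κ * α ≤ κ * ν`, the total is at most `-α + α / 6 + α /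
  -- 6`.
  have h1 : ∑ a, ((π.1 s).real {a} - (1 - κ) * M.optPolicy s a) * meanIncrement M L s a ≤
      ∑ a, ((π.1 s).real {a} - (1 - κ) * M.optPolicy s a) * ν :=
    Finset.sum_le_sum fun a _ => mul_le_mul_of_nonneg_left
      (abs_le.1 (hL.abs_meanIncrement_le s a)).2 (sub_nonneg.2 (hπ a))
  rw [← Finset.sum_mul, Finset.sum_sub_distrib, ← Finset.mul_sum, sum_optPolicy, hsum] at h1
  have h2 : ∑ a, ((π.1 s).real {a} - (1 - κ) * M.optPolicy s a) * meanIncrement M L s a =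
      ∑ a, (π.1 s).real {a} * meanIncrement M L s a -
        (1 - κ) * ∑ a, M.optPolicy s a * meanIncrement M L s a := by
    rw [Finset.mul_sum, ← Finset.sum_sub_distrib]
    exact Finset.sum_congr rfl fun a _ => by ring
  have h3 := mul_le_mul_of_nonneg_left (hL.sum_optPolicy_mul_meanIncrement_le hs)
    (sub_nonneg.2 hκ1)
  have h4 := mul_le_mul_of_nonneg_left hαν hκ0
  linarith

/-- Below the temperature threshold the oracle policy is close to the optimal policy. -/
lemma oraclePolicy_real_ge (hS : ¬ Bornology.IsBounded S) (hL : M.IsLyapunov L ν ν' B α)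
    {τ : ℝ} (hτ : 0 < τ) (hτα : (τ : EReal) ≤ M.tauMax ν α) (s : S) (a : A) :
    (1 - α / (6 * ν)) * M.optPolicy s a ≤
      ((M.oraclePolicy (M.width (τ ^ 2)) (M.depth (τ ^ 2)) τ).1 s).real {a} := by
  have hν := hL.ν_pos
  have hα := hL.α_pos
  have hαν := hL.drift_le_increment hS
  have hR := M.Rmax_pos
  have hγ := sub_pos.2 M.γ_lt_one
  have hN : (1 : ℝ) ≤ Fintype.card A := Nat.one_le_cast.2 Fintype.card_pos
  obtain ⟨⟨⟨hτ1, -⟩, hτ3⟩, hτ4⟩ := by simpa only [tauMax, le_min_iff] using hτα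
  rw [EReal.coe_le_coe_iff] at hτ1 hτ3
  set g := Real.log (24 * ν * (Fintype.card A : ℝ) / α) with hg
  have hg1 : 1 < 24 * ν * (Fintype.card A : ℝ) / α := by
    rw [one_lt_div hα]
    nlinarith
  have hg0 : 0 < g := Real.log_pos hg1
  have hexp : (Fintype.card A : ℝ) * Real.exp (-g) = α / (24 * ν) := by
    rw [Real.exp_neg, hg, Real.exp_log (by linarith)]
    field_simp
  have hτsq : τ ^ 2 ≤ α / (24 * ν) := (Real.le_sqrt hτ.le (by positivity)).1 hτ1
  have hx : α / (24 * ν) ≤ 1 / 24 := by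
    rw [div_le_div_iff₀ (by positivity) (by positivity)]
    linarith
  have hV : 4 * τ * M.Vmax ≤ α / (12 * ν) := by
    rw [le_div_iff₀ (by positivity)] at hτ3
    unfold Vmax
    rw [← mul_div_assoc, div_le_div_iff₀ hγ (by positivity)]
    have h1 : 4 * τ * M.Rmax * (12 * ν) ≤
        τ * (48 * M.Rmax * (Fintype.card A : ℝ) ^ 2 * ν) := by
      have h2 : (1 : ℝ) ≤ (Fintype.card A : ℝ) ^ 2 := one_le_pow₀ hN
      have h3 : 0 < 48 * τ * M.Rmax * ν := by positivity
      nlinarith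
    linarith
  -- The margin `α / (6 * ν)` is spent as `α / (12 * ν)` on estimation errors, `α / (24 * ν)` on
  -- suboptimal actions and `α / (24 * ν)` on oracle failure.
  have h8 : α / (12 * ν) + α / (24 * ν) = α / (8 * ν) := by
    field_simp
    norm_num
  have h6 : α / (6 * ν) = α / (8 * ν) + α / (24 * ν) := by
    field_simp
    norm_num
  have hmain := M.oraclePolicy_ge hτ (by linarith) hg0 hτ4 (η := α / (8 * ν))
    (by rw [hexp]; linarith) s a
  have h9 : 0 ≤ α / (8 * ν) := by positivity
  refine le_trans ?_ ((ENNReal.ofReal_le_iff_le_toReal (measure_ne_top _ _)).1 hmain)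
  refine mul_le_mul_of_nonneg_right ?_ (M.optPolicy_nonneg s a)
  nlinarith [mul_nonneg (sq_nonneg τ) h9]

end MDP.IsLyapunov

end StableRL

end

theorem theorem1 {d : ℕ} {S : Set (EuclideanSpace ℝ (Fin d))} (hS : ¬ Bornology.IsBounded S)
    {A : Type*} [Fintype A] [Nonempty A] [MeasurableSpace A] [DiscreteMeasurableSpace A]
    (M : StableRL.MDP S A) (hgap : 0 < M.gap)
    {L : S → ℝ} {ν ν' B α : ℝ} (hL : M.IsLyapunov L ν ν' B α)
    {τ : ℝ} (hτ : 0 < τ) (hτα : (τ : EReal) ≤ M.tauMax ν α) :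
    M.Stable fun _ => M.oraclePolicy (M.width (τ ^ 2)) (M.depth (τ ^ 2)) τ := by
  have hν := hL.ν_pos
  have hα := hL.α_pos
  have hαν := hL.drift_le_increment hS
  set π := M.oraclePolicy (M.width (τ ^ 2)) (M.depth (τ ^ 2)) τ with hπ
  set x := α / ν with hx
  have hx0 : 0 < x := div_pos hα hν
  have hx1 : x ≤ 1 := (div_le_one hν).2 hαν
  -- With `x = α / ν`, the drift contributes `-x ^ 2 / 8` and the quadratic remainder `(η * ν) ^ 2 =
  -- x ^ 2 / 16`, which leaves the rate `1 - x ^ 2 / 16`.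
  set η := α / (4 * ν ^ 2) with hη
  have hη0 : 0 < η := by positivity
  have hην : η * ν = x / 4 := by
    rw [hη, hx]
    field_simp
  have hηα : η * (α / 2) = x ^ 2 / 8 := by
    rw [hη, hx]
    field_simp
    norm_num
  have hην1 : η * ν ≤ 1 := by linarith
  -- The factor 3 is a crude bound for `1 + x / 4 + x ^ 2 / 16` with `x ≤ 1`.
  refine M.stable_of_exp_drift π hL.measurable hL.nonneg hL.isBounded_sublevel hη0
    (r := 1 - x ^ 2 / 16) (b := Real.exp (η * B) * 3) (B := B) ?_ ?_ (by positivity) ?_ ?_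
  · nlinarith
  · nlinarith
  · intro s hs
    refine (hL.lintegral_policy_exp_le hη0.le hην1 π s).trans ?_
    rw [mul_comm (ENNReal.ofReal _), ← ENNReal.ofReal_mul (Real.exp_pos _).le]
    refine ENNReal.ofReal_le_ofReal (mul_le_mul_of_nonneg_left ?_ (Real.exp_pos _).le)
    have h1 := mul_le_mul_of_nonneg_left (hL.sum_policy_mul_meanIncrement_le hS π
      (hL.oraclePolicy_real_ge hS hτ hτα s) hs) hη0.le
    rw [hην]
    linarith
  · intro s hs
    refine (hL.lintegral_policy_exp_le hη0.le hην1 π s).trans (ENNReal.ofReal_le_ofReal ?_)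
    have h1 := hL.sum_policy_mul_meanIncrement_le_increment π s
    have h2 := mul_le_mul_of_nonneg_left h1 hη0.le
    refine (mul_le_mul_of_nonneg_left ?_ (Real.exp_pos _).le).trans
      (mul_le_mul_of_nonneg_right (Real.exp_le_exp.2 (mul_le_mul_of_nonneg_left hs hη0.le))
        (by norm_num))
    rw [hην] at h2 ⊢
    nlinarith
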